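/- **Setting (categories with an initial unit).** Let $(\mathcal M,\oplus,0)$ be a small symmetric monoidal category whose unit $0$ is an initial object, and let $\mathcal B$ be a Grothendieck category. Write $\mathbf{Fct}(\mathcal M,\mathcal B)$ for the category of functors $\mathcal M\to\mathcal B$. For $x\in\mathcal M$ let $\tau_x$ be the endofunctor of $\mathbf{Fct}(\mathcal M,\mathcal B)$ given by precomposition with $x\oplus -$, let $i_x:\mathrm{Id}\to\tau_x$ be the natural transformation induced by the unique morphism $0\to x$, and put $\kappa_x=\ker i_x$, $\delta_x=\operatorname{coker} i_x$. A functor $F$ is *stably null* if $F=\sum_{x\in\mathcal M}\kappa_x(F)$. Stably null functors form a Serre subcategory $\mathcal Sn(\mathcal M,\mathcal B)$; let $\mathbf{St}(\mathcal M,\mathcal B)=\mathbf{Fct}(\mathcal M,\mathcal B)/\mathcal Sn(\mathcal M,\mathcal B)$ and let $\pi_{\mathcal M}:\mathbf{Fct}(\mathcal M,\mathcal B)\to\mathbf{St}(\mathcal M,\mathcal B)$ be the quotient functor. The functors $\delta_x$ induce endofunctors of $\mathbf{St}(\mathcal M,\mathcal B)$, again denoted $\delta_x$. Full subcategories $\mathcal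 Pol_n(\mathcal M,\mathcal B)$ of $\mathbf{St}(\mathcal M,\mathcal B)$ are defined by induction: $\mathcal Pol_n$ consists of the zero objects if $n<0$, and for $n\ge 0$ it consists of the objects $X$ such that $\delta_x(X)\in\mathcal Pol_{n-1}(\mathcal M,\mathcal B)$ for all $x\in\mathcal M$. **Setting (hermitian objects).** Let $\mathcal A$ be a small additive category, regarded as symmetric monoidal through the direct sum; its unit is a zero object, so that no nonzero functor on $\mathcal A$ is stably null, $\mathbf{St}(\mathcal A,\mathcal B)=\mathbf{Fct}(\mathcal A,\mathcal B)$, and $\mathcal Pol_n(\mathcal A,\mathcal B)$ is a full subcategory of $\mathbf{Fct}(\mathcal A,\mathcal B)$. Let $D:\mathcal A^{op}\to\mathcal A$ be a duality functor: it comes with isomorphisms of abelian groups $\sigma_{X,Y}:\mathcal A(X,DY)\to\mathcal A(Y,DX)$, natural in $X$ and $Y$, such that $\sigma_{Y,X}=\sigma_{X,Y}^{-1}$ and such that the unit $X\to D^2X$, i.e. $\sigma_{DX,X}(\mathrm{id}_{DX})$, is an isomorphism for all $X$. Put $TD^2(X)=\mathcal A(X,DX)$, a functor $\mathcal A^{op}\to\mathbf{Ab}$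 with involution $\bar u=\sigma_{X,X}(u)$. Let $\varepsilon\in\{1,-1\}$ and let $T:\mathcal A^{op}\to\mathbf{Ab}$ be one of the following two functors: - $SD^2_\varepsilon(X)=TD^2(X)/\{u-\varepsilon\bar u\}$, with the canonical map $SD^2_\varepsilon\to TD^2$ induced by $u\mapsto u+\varepsilon\bar u$; - $\bar SD^2_\varepsilon(X)=\{u+\varepsilon\bar u\}\subset TD^2(X)$, with the inclusion $\bar SD^2_\varepsilon\to TD^2$. Let $\mathbf H(\mathcal A)$ be the category whose objects are the pairs $(X,u)$ with $X\in\mathcal A$ and $u\in T(X)$ such that the image of $u$ in $TD^2(X)=\mathcal A(X,DX)$ is an isomorphism, and whose morphisms $(X,u)\to(Y,v)$ are the $f\in\mathcal A(X,Y)$ with $T(f)(v)=u$. With the orthogonal sum $$(X,u)\oplus(Y,v)=(X\oplus Y,\;T(p_X)(u)+T(p_Y)(v)),$$ where $p_X,p_Y$ are the projections, it is a small symmetric monoidal category whose unit $(0,0)$ is initial. Let $\pi^T:\mathbf H(\mathcal A)\to\mathcal A$, $(X,u)\mapsto X$, be the forgetful functor, and $(\pi^T)^*:\mathbf{Fct}(\mathcal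 A,\mathcal B)\to\mathbf{Fct}(\mathbf H(\mathcal A),\mathcal B)$ precomposition with it. **Statement.** For every $n\in\mathbb N$, $\mathcal Pol_n(\mathbf H(\mathcal A),\mathcal B)$ is the smallest full subcategory $\mathcal C$ of $\mathbf{St}(\mathbf H(\mathcal A),\mathcal B)$ such that: 1. $\mathcal C$ contains $\pi_{\mathbf H(\mathcal A)}\big((\pi^T)^*F\big)$ for every $F\in\mathcal Pol_n(\mathcal A,\mathcal B)$; 2. $\mathcal C$ is stable under kernels of epimorphisms: for every short exact sequence $0\to X\to Y\to Z\to 0$ of $\mathbf{St}(\mathbf H(\mathcal A),\mathcal B)$ with $Y,Z\in\mathcal C$, one has $X\in\mathcal C$; 3. $\mathcal C$ is stable under extensions: for every such sequence with $X,Z\in\mathcal C$, one has $Y\in\mathcal C$. In particular $\mathcal Pol_n(\mathbf H(\mathcal A),\mathcal B)$ itself has these three properties. -/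

import Mathlib

open CategoryTheory Limits MonoidalCategory

universe w u

namespace WeakPoly

/-- The unit of the monoidal category `M` is an initial object. -/
class UnitInitial (M : Type w) [SmallCategory M] [MonoidalCategory M] where
  isInitial : IsInitial (𝟙_ M)

section Functors

variable {M : Type w} [SmallCategory M] [MonoidalCategory M]

/-- The translation functor `τ_x`: precomposition with `x ⊕ -`. -/
abbrev tau {B : Type u} [Category.{w} B] (x : M) : (M ⥤ B) ⥤ (M ⥤ B) :=
  (Functor.whiskeringLeft M M B).obj (tensorLeft x)

/-- The map `z ≅ 0 ⊕ z ⟶ x ⊕ z` induced by the unique map `0 ⟶ x`. -/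
def unitTo [UnitInitial M] (x z : M) : z ⟶ x ⊗ z :=
  (λ_ z).inv ≫ UnitInitial.isInitial.to x ▷ z

lemma unitTo_naturality [UnitInitial M] (x : M) {z z' : M} (f : z ⟶ z') :
    f ≫ unitTo x z' = unitTo x z ≫ x ◁ f := by
  rw [unitTo, unitTo, Category.assoc, ← whisker_exchange, leftUnitor_inv_naturality_assoc]

lemma unitTo_tensor [UnitInitial M] (x y z : M) :
    unitTo (y ⊗ x) z = unitTo x z ≫ unitTo y (x ⊗ z) ≫ (α_ y x z).inv := by
  have h : (UnitInitial.isInitial.to (y ⊗ x) : 𝟙_ M ⟶ y ⊗ x) =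
      UnitInitial.isInitial.to x ≫ unitTo y x := UnitInitial.isInitial.hom_ext _ _
  rw [unitTo, h]
  simp [unitTo, -IsInitial.to_comp]

lemma whiskerLeft_unitTo [SymmetricCategory M] [UnitInitial M] (x y z : M) :
    x ◁ unitTo y z = unitTo y (x ⊗ z) ≫ (α_ y x z).inv ≫ (β_ y x).hom ▷ z ≫ (α_ x y z).hom := by
  have h : UnitInitial.isInitial.to y ▷ x ≫ (β_ y x).hom =
      (λ_ x).hom ≫ (ρ_ x).inv ≫ x ◁ UnitInitial.isInitial.to y := by
    rw [BraidedCategory.braiding_naturality_left, braiding_tensorUnit_left, Category.assoc]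
  simp only [unitTo, Category.assoc, MonoidalCategory.whiskerLeft_comp]
  rw [associator_inv_naturality_left_assoc, ← comp_whiskerRight_assoc, h]
  simp

/-- The natural transformation `i_x(F) : F ⟶ τ_x(F)`. -/
@[simps]
def iota {B : Type u} [Category.{w} B] [UnitInitial M] (x : M) (F : M ⥤ B) :
    F ⟶ (tau x).obj F where
  app z := F.map (unitTo x z)
  naturality z z' f := by
    dsimp
    rw [← F.map_comp, ← F.map_comp, unitTo_naturality]

lemma iota_naturality {B : Type u} [Category.{w} B] [UnitInitial M] (x : M) {F G : M ⥤ B}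
    (f : F ⟶ G) : f ≫ iota x G = iota x F ≫ (tau x).map f := by
  ext z
  simp

lemma iota_comp_map {B : Type u} [Category.{w} B] [UnitInitial M] {x y : M} (f : x ⟶ y) (F : M ⥤ B) :
    iota x F ≫ Functor.whiskerRight ((tensoringLeft M).map f) F = iota y F := by
  ext z
  simp [unitTo, ← Functor.map_comp, ← comp_whiskerRight]

lemma iota_tensor {B : Type u} [Category.{w} B] [UnitInitial M] 
    (x y : M) (F : M ⥤ B) :
    iota (y ⊗ x) F = iota x F ≫ (tau x).map (iota y F) ≫
      Functor.whiskerRight (tensorLeftTensor y x).inv F := by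
  ext z
  simp [unitTo_tensor, ← Functor.map_comp]

variable {B : Type u} [Category.{w} B] [Abelian B] [UnitInitial M]

/-- `κ_x(F)`, the kernel of `i_x(F) : F ⟶ τ_x(F)`, as a subobject of `F`. -/
noncomputable def kappa (x : M) (F : M ⥤ B) : Subobject F :=
  kernelSubobject (iota x F)

/-- The difference functor `δ_x`: `δ_x(F)` is the cokernel of `i_x(F) : F ⟶ τ_x(F)`. -/
@[simps]
noncomputable def delta (x : M) : (M ⥤ B) ⥤ (M ⥤ B) where
  obj F := cokernel (iota x F)
  map {F G} f := cokernel.map (iota x F) (iota x G) f ((tau x).map f)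
    (iota_naturality x f).symm
  map_id F := by
    rw [← cancel_epi (cokernel.π _), cokernel.π_desc, CategoryTheory.Functor.map_id,
      Category.id_comp, Category.comp_id]
  map_comp {F G H} f g := by
    rw [← cancel_epi (cokernel.π _), cokernel.π_desc, cokernel.π_desc_assoc, Category.assoc,
      cokernel.π_desc, CategoryTheory.Functor.map_comp, Category.assoc]

variable (M B) in
/-- Stably null functors: `F` is the sum of its subobjects `κ_x(F)`, for `x` in `M`. -/
def stablyNull : ObjectProperty (M ⥤ B) :=
  fun F => IsLUB (Set.range fun x : M => kappa x F) ⊤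

/-! ### Stably null functors form a Serre class -/

lemma stablyNull_iff (F : M ⥤ B) : stablyNull M B F ↔
    ∀ ⦃Z : M ⥤ B⦄ (f : F ⟶ Z), (∀ x : M, kernel.ι (iota x F) ≫ f = 0) → f = 0 := by
  constructor
  · intro h Z f hf
    have h1 : (⊤ : Subobject F) ≤ kernelSubobject f := by
      apply h.2
      rintro _ ⟨x, rfl⟩
      refine le_kernelSubobject f _ ?_
      dsimp only [kappa]
      rw [← kernelSubobject_arrow, Category.assoc, hf]
      exact comp_zero
    have h3 : (⊤ : Subobject F).arrow ≫ f = 0 := by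
      rw [← Subobject.ofLE_arrow h1, Category.assoc, kernelSubobject_arrow_comp, comp_zero]
    rw [← cancel_epi (⊤ : Subobject F).arrow, h3, comp_zero]
  · intro h
    refine ⟨fun _ _ => le_top, fun S hS => ?_⟩
    have h1 : cokernel.π S.arrow = 0 := by
      apply h
      intro x
      have h2 : kernelSubobject (iota x F) ≤ S := hS ⟨x, rfl⟩
      rw [← kernelSubobject_arrow', ← Subobject.ofLE_arrow h2, Category.assoc, Category.assoc,
        cokernel.condition, comp_zero, comp_zero]
    have : Epi S.arrow := Preadditive.epi_of_cokernel_zero h1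
    have : IsIso S.arrow := isIso_of_mono_of_epi _
    exact (Subobject.eq_top_of_isIso_arrow S).ge

lemma stablyNull_iff' (F : M ⥤ B) : stablyNull M B F ↔
    ∀ ⦃Z : M ⥤ B⦄ (f : F ⟶ Z),
      (∀ (x : M) ⦃W : M ⥤ B⦄ (p : W ⟶ F), p ≫ iota x F = 0 → p ≫ f = 0) → f = 0 := by
  rw [stablyNull_iff]
  refine ⟨fun h Z f hf => h f fun x => hf x _ (kernel.condition _), fun h Z f hf => h f ?_⟩
  intro x W p hp
  rw [← kernel.lift_ι (iota x F) p hp, Category.assoc, hf, comp_zero]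

lemma jointlyEpi_pullback {C : Type*} [Category* C] [Abelian C] {J : Type w} [SmallCategory J]
    [IsFiltered J] [HasColimitsOfShape J C] [HasExactColimitsOfShape J C]
    {K : J ⥤ C} (c : Cocone K)
    (hc : ∀ ⦃Z : C⦄ (f : c.pt ⟶ Z), (∀ j, c.ι.app j ≫ f = 0) → f = 0)
    {G Z : C} (g : G ⟶ c.pt) (f : G ⟶ Z)
    (hf : ∀ (j : J) ⦃W : C⦄ (p : W ⟶ G) (q : W ⟶ K.obj j),
      p ≫ g = q ≫ c.ι.app j → p ≫ f = 0) : f = 0 := by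
  have := IsFiltered.isConnected J
  let κ : K ⟶ (Functor.const J).obj c.pt := c.ι
  have hepi : Epi (colim.map κ) := by
    rw [Preadditive.epi_iff_cancel_zero]
    intro Z h hh
    let j₀ : J := Classical.arbitrary J
    have hj : ∀ j, colimit.ι ((Functor.const J).obj c.pt) j =
        colimit.ι ((Functor.const J).obj c.pt) j₀ := fun j => by
      have := colimit.w ((Functor.const J).obj c.pt) (IsFiltered.leftToMax j j₀)
      have h2 := colimit.w ((Functor.const J).obj c.pt) (IsFiltered.rightToMax j j₀)
      simp only [Functor.const_obj_obj, Functor.const_obj_map, Category.id_comp] at this h2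
      rw [← this, ← h2]
    have h0 : colimit.ι ((Functor.const J).obj c.pt) j₀ ≫ h = 0 := by
      apply hc
      intro j
      have := colimit.ι_map κ j
      have h3 := congrArg (fun t => colimit.ι K j ≫ t) hh
      dsimp at h3
      rw [comp_zero] at h3
      erw [reassoc_of% this] at h3
      rw [← hj j]
      exact h3
    refine colimit.hom_ext fun j => ?_
    rw [hj j, h0, comp_zero]
  let γ : (Functor.const J).obj G ⟶ (Functor.const J).obj c.pt := (Functor.const J).map g
  have sq := (IsPullback.of_hasPullback γ κ).map colim
  have hepi' : Epi (colim.map (pullback.fst γ κ)) := Abelian.epi_fst_of_isLimit _ _ sq.isLimit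
  let d : Cocone ((Functor.const J).obj G) := (Cocone.mk Z ((Functor.const J).map f))
  have hd : colim.map (pullback.fst γ κ) ≫ colimit.desc _ d = 0 := by
    refine colimit.hom_ext fun j => ?_
    have h1 := hf j ((pullback.fst γ κ).app j) ((pullback.snd γ κ).app j)
      (NatTrans.congr_app (pullback.condition (f := γ) (g := κ)) j)
    have := colimit.ι_map_assoc (pullback.fst γ κ) j (colimit.desc _ d)
    rw [comp_zero]
    refine this.trans ?_
    rw [colimit.ι_desc]
    exact h1
  have hd' : colimit.desc _ d = 0 := by
    rwa [← cancel_epi (colim.map (pullback.fst γ κ)), comp_zero]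
  have hj := colimit.ι_desc d (Classical.arbitrary J)
  rw [hd', comp_zero] at hj
  exact hj.symm

/-- The objects of `M`, preordered by the existence of a morphism. -/
structure HomPreorder (M : Type w) where
  as : M

instance : Preorder (HomPreorder M) where
  le x y := Nonempty (x.as ⟶ y.as)
  le_refl x := ⟨𝟙 _⟩
  le_trans _ _ _ := fun ⟨f⟩ ⟨g⟩ => ⟨f ≫ g⟩

instance : Nonempty (HomPreorder M) := ⟨⟨𝟙_ M⟩⟩

instance : IsDirectedOrder (HomPreorder M) where
  directed x y := ⟨⟨x.as ⊗ y.as⟩, ⟨(ρ_ _).inv ≫ x.as ◁ UnitInitial.isInitial.to y.as⟩,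
    ⟨unitTo x.as y.as⟩⟩

/-- The directed system of the kernels `κ_x(F)`. -/
noncomputable def kernelDiagram (F : M ⥤ B) : HomPreorder M ⥤ (M ⥤ B) where
  obj x := kernel (iota x.as F)
  map {x y} f := kernel.lift _ (kernel.ι _) (by
    rw [← iota_comp_map (leOfHom f).some, kernel.condition_assoc, zero_comp])
  map_id x := by rw [← cancel_mono (kernel.ι _)]; simp
  map_comp f g := by rw [← cancel_mono (kernel.ι _)]; simp

/-- The inclusions of the kernels `κ_x(F)` into `F`. -/
noncomputable def kernelCocone (F : M ⥤ B) : Cocone (kernelDiagram F) where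
  pt := F
  ι :=
    { app := fun x => kernel.ι (iota x.as F)
      naturality := fun x y f => by simp [kernelDiagram] }

variable [IsGrothendieckAbelian.{w} B]

lemma stablyNull_pullback {F G Z : M ⥤ B} (hF : stablyNull M B F) (g : G ⟶ F) (f : G ⟶ Z)
    (hf : ∀ (x : M) ⦃W : M ⥤ B⦄ (p : W ⟶ G), p ≫ g ≫ iota x F = 0 → p ≫ f = 0) : f = 0 := by
  refine jointlyEpi_pullback (kernelCocone F)
    (fun Z f hf => (stablyNull_iff F).1 hF f fun x => hf ⟨x⟩) g f ?_
  intro x W p (q : W ⟶ kernel (iota x.as F)) h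
  refine hf x.as p ?_
  have h' : p ≫ g = q ≫ kernel.ι (iota x.as F) := h
  rw [reassoc_of% h', kernel.condition, comp_zero]

lemma tau_jointlyEpi {F : M ⥤ B} (hF : stablyNull M B F) (x : M) ⦃Z : M ⥤ B⦄
    (f : (tau x).obj F ⟶ Z)
    (hf : ∀ y : M, (tau x).map (kernel.ι (iota y F)) ≫ f = 0) : f = 0 := by
  let K := kernelDiagram F
  let φ : colimit K ⟶ F := colimit.desc K (kernelCocone F)
  have hφ : Epi φ := by
    rw [Preadditive.epi_iff_cancel_zero]
    intro Z f hf
    refine (stablyNull_iff F).1 hF f fun y => ?_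
    have := colimit.ι_desc_assoc (kernelCocone F) ⟨y⟩ f
    refine this.symm.trans ?_
    change _ ≫ φ ≫ f = 0
    rw [hf, comp_zero]
  have : Epi ((tau x).map φ) := inferInstance
  rw [← cancel_epi ((tau x).map φ), comp_zero]
  refine (isColimitOfPreserves (tau x) (colimit.isColimit K)).hom_ext fun y => ?_
  rw [comp_zero]
  have h1 : (tau x).map (colimit.ι K y) ≫ (tau x).map φ =
      (tau x).map (kernel.ι (iota y.as F)) := by
    rw [← Functor.map_comp]
    congr 1
    exact colimit.ι_desc (kernelCocone F) y
  change (tau x).map (colimit.ι K y) ≫ (tau x).map φ ≫ f = 0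
  rw [reassoc_of% h1]
  exact hf y.as

lemma tau_stablyNull_pullback {F G Z : M ⥤ B} (hF : stablyNull M B F) (x : M)
    (g : G ⟶ (tau x).obj F) (f : G ⟶ Z)
    (hf : ∀ (y : M) ⦃W : M ⥤ B⦄ (p : W ⟶ G), p ≫ g ≫ (tau x).map (iota y F) = 0 →
      p ≫ f = 0) : f = 0 := by
  refine jointlyEpi_pullback ((tau x).mapCocone (kernelCocone F))
    (fun Z f hf => tau_jointlyEpi hF x f fun y => hf ⟨y⟩) g f ?_
  intro y W p (q : W ⟶ (tau x).obj (kernel (iota y.as F))) h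
  refine hf y.as p ?_
  have h' : p ≫ g = q ≫ (tau x).map (kernel.ι (iota y.as F)) := h
  rw [reassoc_of% h', ← Functor.map_comp, kernel.condition, Functor.map_zero, comp_zero]

instance : (stablyNull M B).IsClosedUnderQuotients where
  prop_of_epi {F G} g _ hF := by
    rw [stablyNull_iff'] at hF ⊢
    intro Z f hf
    rw [← cancel_epi g, comp_zero]
    refine hF _ fun x W p hp => ?_
    rw [← Category.assoc]
    apply hf x
    rw [Category.assoc, iota_naturality, reassoc_of% hp, zero_comp]

instance : (stablyNull M B).IsClosedUnderSubobjects where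
  prop_of_mono {G F} g _ hF := by
    rw [stablyNull_iff']
    intro Z f hf
    refine stablyNull_pullback hF g f fun x W p hp => hf x p ?_
    rw [← cancel_mono ((tau x).map g), Category.assoc, ← iota_naturality, hp, zero_comp]

instance : (stablyNull M B).IsClosedUnderExtensions where
  prop_X₂_of_shortExact {S} hS h₁ h₃ := by
    have := hS.mono_f
    have := hS.epi_g
    rw [stablyNull_iff']
    intro Z f hf
    refine stablyNull_pullback h₃ S.g f fun x W p hp => ?_
    have hex : (S.map (tau x)).ShortExact := hS.map_of_exact (tau x)
    have hp' : (p ≫ iota x S.X₂) ≫ (S.map (tau x)).g = 0 := by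
      change (p ≫ iota x S.X₂) ≫ (tau x).map S.g = 0
      rw [Category.assoc, ← iota_naturality, hp]
    have : Mono (S.map (tau x)).f := hex.mono_f
    let φ : W ⟶ (tau x).obj S.X₁ := hex.exact.lift _ hp'
    have hφ : φ ≫ (tau x).map S.f = p ≫ iota x S.X₂ := hex.exact.lift_f _ hp'
    refine tau_stablyNull_pullback h₁ x φ (p ≫ f) fun y W' p' hp'' => ?_
    rw [← Category.assoc]
    refine hf (y ⊗ x) _ ?_
    rw [iota_tensor, Category.assoc, ← reassoc_of% hφ, ← Functor.map_comp_assoc,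
      iota_naturality, Functor.map_comp_assoc, reassoc_of% hp'', zero_comp]

instance : (stablyNull M B).ContainsZero where
  exists_zero := by
    obtain ⟨F, hF⟩ := (inferInstance : HasZeroObject (M ⥤ B))
    exact ⟨F, hF, (stablyNull_iff F).2 fun Z f _ => hF.eq_of_src _ _⟩

instance : (stablyNull M B).IsSerreClass where

/-! ### The stable category -/

section Stable

variable (M B) in
/-- The stable category `St(M, B)`: the quotient of the category of functors `M ⥤ B` by the
Serre subcategory of stably null functors. -/
abbrev St : Type (max u w) := (stablyNull M B).isoModSerre.Localization

variable (M B) in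
/-- The canonical functor from functors to the stable category. -/
noncomputable abbrev proj : (M ⥤ B) ⥤ St M B := (stablyNull M B).isoModSerre.Q

variable [SymmetricCategory M]

lemma stablyNull_tau (x : M) {F : M ⥤ B} (hF : stablyNull M B F) :
    stablyNull M B ((tau x).obj F) := by
  rw [stablyNull_iff']
  intro Z f hf
  refine tau_jointlyEpi hF x f fun y => hf y _ ?_
  ext z
  have hz : (kernel.ι (iota y F)).app (x ⊗ z) ≫ F.map (unitTo y (x ⊗ z)) = 0 :=
    NatTrans.congr_app (kernel.condition (iota y F)) (x ⊗ z)
  change (kernel.ι (iota y F)).app (x ⊗ z) ≫ F.map (x ◁ unitTo y z) = 0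
  rw [whiskerLeft_unitTo, F.map_comp, reassoc_of% hz, zero_comp]

lemma isoModSerre_tau (x : M) {F G : M ⥤ B} (f : F ⟶ G)
    (hf : (stablyNull M B).isoModSerre f) : (stablyNull M B).isoModSerre ((tau x).map f) :=
  ⟨(stablyNull M B).prop_of_iso (PreservesKernel.iso (tau x) f) (stablyNull_tau x hf.1),
    (stablyNull M B).prop_of_iso (PreservesCokernel.iso (tau x) f) (stablyNull_tau x hf.2)⟩

lemma delta_proj_inverts (x : M) :
    (stablyNull M B).isoModSerre.IsInvertedBy (delta x ⋙ proj M B) := by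
  intro F G f hf
  have h1 : IsIso ((proj M B).map f) := Localization.inverts _ (stablyNull M B).isoModSerre _ hf
  have h2 : IsIso ((proj M B).map ((tau x).map f)) :=
    Localization.inverts _ (stablyNull M B).isoModSerre _ (isoModSerre_tau x f hf)
  have := ObjectProperty.SerreClassLocalization.preservesCokernel (proj M B)
    (stablyNull M B) (iota x F)
  have := ObjectProperty.SerreClassLocalization.preservesCokernel (proj M B)
    (stablyNull M B) (iota x G)
  have := ObjectProperty.SerreClassLocalization.hasCokernels (proj M B) (stablyNull M B)
  have hM : IsIso (cokernel.map ((proj M B).map (iota x F)) ((proj M B).map (iota x G))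
      ((proj M B).map f) ((proj M B).map ((tau x).map f))
      (by rw [← Functor.map_comp, ← Functor.map_comp, iota_naturality])) :=
    (cokernel.mapIso ((proj M B).map (iota x F)) ((proj M B).map (iota x G)) (asIso ((proj M B).map f))
      (asIso ((proj M B).map ((tau x).map f)))
      (by simp only [asIso_hom, ← Functor.map_comp, iota_naturality])).isIso_hom
  have h3 := preserves_cokernel_iso_comp_cokernel_map (G := proj M B) (f := iota x F)
    (g := iota x G) (p := f) (q := (tau x).map f) (hpq := (iota_naturality x f).symm)
  have h4 : (proj M B).map ((delta x).map f) = _ := (Iso.eq_comp_inv _).2 h3.symm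
  rw [Functor.comp_map, h4]
  exact IsIso.comp_isIso' (IsIso.comp_isIso' (Iso.isIso_hom _) hM) (Iso.isIso_inv _)

/-- The difference functor on the stable category, induced by `delta x` on functors. -/
noncomputable def stDelta (x : M) : St M B ⥤ St M B :=
  Localization.lift (delta x ⋙ proj M B) (delta_proj_inverts x) (proj M B)

variable (M B) in
/-- Polynomial objects of degree at most `n` in the stable category: the objects `X` such that
`δ_x(X)` is polynomial of degree at most `n - 1` for all `x`, the objects of negative degree being
the zero objects. -/
def Pol : ℕ → ObjectProperty (St M B)
  | 0 => fun X => ∀ x : M, IsZero ((stDelta x).obj X)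
  | n + 1 => fun X => ∀ x : M, Pol n ((stDelta x).obj X)

end Stable

end Functors

/-! ### Additive categories with duality -/

section Duality

variable (A : Type w) [SmallCategory A] [Preadditive A]

/-- A duality on a preadditive category `A`: a contravariant functor `D` with isomorphisms of
abelian groups `σ : A(X, D Y) ≃ A(Y, D X)`, natural in both variables, such that `σ_{Y, X}` is the
inverse of `σ_{X, Y}` and the unit `X ⟶ D (D X)` is an isomorphism. -/
structure Duality where
  /-- The duality functor. -/
  D : Aᵒᵖ ⥤ A
  /-- The adjunction isomorphism. -/
  σ (X Y : A) : (X ⟶ D.obj (.op Y)) ≃+ (Y ⟶ D.obj (.op X))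
  σ_naturality_left {X' X Y : A} (f : X' ⟶ X) (u : X ⟶ D.obj (.op Y)) :
    σ X' Y (f ≫ u) = σ X Y u ≫ D.map f.op
  σ_naturality_right {X Y' Y : A} (g : Y' ⟶ Y) (u : X ⟶ D.obj (.op Y)) :
    σ X Y' (u ≫ D.map g.op) = g ≫ σ X Y u
  σ_symm (X Y : A) (u : X ⟶ D.obj (.op Y)) : σ Y X (σ X Y u) = u
  isIso_unit (X : A) : IsIso (σ (D.obj (.op X)) X (𝟙 (D.obj (.op X))))

end Duality

section Forms

variable {A : Type w} [SmallCategory A] [Preadditive A] (𝔇 : Duality A)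

/-- The duality functor is automatically additive. -/
lemma Duality.map_add {X Y : A} (f g : X ⟶ Y) :
    𝔇.D.map (f + g).op = 𝔇.D.map f.op + 𝔇.D.map g.op := by
  have := 𝔇.isIso_unit Y
  have h (f : X ⟶ Y) : 𝔇.D.map f.op =
      𝔇.σ _ _ (f ≫ 𝔇.σ (𝔇.D.obj (.op Y)) Y (𝟙 (𝔇.D.obj (.op Y)))) := by
    rw [𝔇.σ_naturality_left, 𝔇.σ_symm, Category.id_comp]
  rw [h, h, h, Preadditive.add_comp, _root_.map_add]

/-- The functor `TD²`, with `TD²(X) = A(X, D X)`; a morphism `f : X ⟶ Y` acts by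
`u ↦ D(f) ∘ u ∘ f`. -/
@[simps]
def Duality.TD2 : Aᵒᵖ ⥤ AddCommGrpCat.{w} where
  obj X := .of (X.unop ⟶ 𝔇.D.obj X)
  map f := AddCommGrpCat.ofHom
    { toFun := fun u => f.unop ≫ u ≫ 𝔇.D.map f
      map_zero' := by simp
      map_add' := fun u v => by simp }
  map_id X := by ext u; simp
  map_comp f g := by ext u; simp

/-- The involution `u ↦ ū` of `TD²`. -/
def Duality.bar : 𝔇.TD2 ⟶ 𝔇.TD2 where
  app X := AddCommGrpCat.ofHom (𝔇.σ X.unop X.unop).toAddMonoidHom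
  naturality X Y f := by
    ext (u : X.unop ⟶ 𝔇.D.obj X)
    change 𝔇.σ Y.unop Y.unop (f.unop ≫ u ≫ 𝔇.D.map f) =
      f.unop ≫ 𝔇.σ X.unop X.unop u ≫ 𝔇.D.map f
    rw [𝔇.σ_naturality_left f.unop (u ≫ 𝔇.D.map f), Quiver.Hom.op_unop,
      ← Category.assoc f.unop]
    congr 1
    exact 𝔇.σ_naturality_right f.unop u

lemma Duality.bar_bar : 𝔇.bar ≫ 𝔇.bar = 𝟙 _ := by
  ext X (u : X.unop ⟶ 𝔇.D.obj X)
  exact 𝔇.σ_symm X.unop X.unop u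

/-- The two kinds of forms: `sym` for `SD²_ε` and `symBar` for `S̄D²_ε`. -/
inductive FormKind
  | sym
  | symBar

noncomputable section

variable (ε : ℤˣ)

/-- The norm `u ↦ u + ε ū`. -/
def Duality.norm : 𝔇.TD2 ⟶ 𝔇.TD2 := 𝟙 _ + (ε : ℤ) • 𝔇.bar

/-- The natural transformation `u ↦ u - ε ū`. -/
def Duality.antinorm : 𝔇.TD2 ⟶ 𝔇.TD2 := 𝟙 _ - (ε : ℤ) • 𝔇.bar

lemma Duality.antinorm_norm : 𝔇.antinorm ε ≫ 𝔇.norm ε = 0 := by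
  have h : ((ε : ℤ) * (ε : ℤ)) = 1 := by
    rw [← Units.val_mul, Int.units_mul_self, Units.val_one]
  rw [Duality.antinorm, Duality.norm, Preadditive.sub_comp, Preadditive.comp_add,
    Preadditive.comp_add, Preadditive.zsmul_comp, Preadditive.zsmul_comp, Preadditive.comp_zsmul,
    Preadditive.comp_zsmul, Duality.bar_bar, smul_smul, h]
  simp only [Category.id_comp, Category.comp_id, one_smul]
  abel

/-- The functor `T` of forms: either `SD²_ε`, the functor of coinvariants of `TD²`, i.e. the
quotient of `TD²` by the elements `u - ε ū`, or `S̄D²_ε`, the image of the norm `u ↦ u + ε ū`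
in `TD²`. -/
def Duality.forms : FormKind → (Aᵒᵖ ⥤ AddCommGrpCat.{w})
  | .sym => cokernel (𝔇.antinorm ε)
  | .symBar => image (𝔇.norm ε)

/-- The canonical morphism `T ⟶ TD²`: it is induced by the norm for `SD²_ε`, and it is the
inclusion for `S̄D²_ε`. -/
def Duality.toTD2 : (k : FormKind) → (𝔇.forms ε k ⟶ 𝔇.TD2)
  | .sym => cokernel.desc (𝔇.antinorm ε) (𝔇.norm ε) (𝔇.antinorm_norm ε)
  | .symBar => image.ι (𝔇.norm ε)

end

end Forms

/-! ### Objects endowed with a form -/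

/-- The map `T(f) : T(Y) ⟶ T(X)` induced by `f : X ⟶ Y`. -/
def res {A : Type w} [SmallCategory A] (T : Aᵒᵖ ⥤ AddCommGrpCat.{w}) {X Y : A} (f : X ⟶ Y) :
    T.obj (.op Y) →+ T.obj (.op X) :=
  (T.map f.op).hom

section

variable {A : Type w} [SmallCategory A] (T : Aᵒᵖ ⥤ AddCommGrpCat.{w})

@[simp]
lemma res_id {X : A} (u : T.obj (.op X)) : res T (𝟙 X) u = u := by
  simp [res]

@[simp]
lemma res_res {X Y Z : A} (f : X ⟶ Y) (g : Y ⟶ Z) (u : T.obj (.op Z)) :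
    res T f (res T g u) = res T (f ≫ g) u := by
  simp [res]

end

/-- The category `A^T`: an object is an object of `A` together with an element (a form) of its
image under `T`. -/
structure Formed {A : Type w} [SmallCategory A] (T : Aᵒᵖ ⥤ AddCommGrpCat.{w}) where
  /-- The underlying object. -/
  obj : A
  /-- The form. -/
  form : T.obj (.op obj)

namespace Formed

section Category

variable {A : Type w} [SmallCategory A] {T : Aᵒᵖ ⥤ AddCommGrpCat.{w}}

/-- Morphisms in `A^T` are the morphisms of `A` which are compatible with the forms. -/
@[ext]
structure Hom (X Y : Formed T) where
  /-- The underlying morphism. -/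
  hom : X.obj ⟶ Y.obj
  w : res T hom Y.form = X.form

@[simps]
instance : SmallCategory (Formed T) where
  Hom X Y := Hom X Y
  id X := { hom := 𝟙 _, w := by simp }
  comp f g := { hom := f.hom ≫ g.hom, w := by rw [← res_res, g.w, f.w] }

@[ext]
lemma hom_ext {X Y : Formed T} {f g : X ⟶ Y} (h : f.hom = g.hom) : f = g := Hom.ext h

variable (T) in
/-- The forgetful functor `π^T : A^T ⥤ A`. -/
@[simps]
def forget : Formed T ⥤ A where
  obj X := X.obj
  map f := f.hom

instance : (forget T).Faithful where
  map_injective h := hom_ext h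

/-- An isomorphism of `A` compatible with the forms is an isomorphism of `A^T`. -/
@[simps]
def isoMk {X Y : Formed T} (e : X.obj ≅ Y.obj) (w : res T e.hom Y.form = X.form) : X ≅ Y where
  hom := { hom := e.hom, w := w }
  inv := { hom := e.inv, w := by
             rw [← w, res_res, e.inv_hom_id, res_id] }

end Category

/-! ### The orthogonal sum -/

section Monoidal

open CartesianMonoidalCategory

variable {A : Type w} [SmallCategory A] [CartesianMonoidalCategory A]
  {T : Aᵒᵖ ⥤ AddCommGrpCat.{w}}

lemma res_sum {P X Y : A} (f : P ⟶ X ⊗ Y) (x : T.obj (.op X)) (y : T.obj (.op Y)) :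
    res T f (res T (fst X Y) x + res T (snd X Y) y) =
      res T (f ≫ fst X Y) x + res T (f ≫ snd X Y) y := by
  rw [map_add, res_res, res_res]

/-- The orthogonal sum, whose underlying object is the direct sum, with neutral element the zero
object with the zero form. -/
@[simps]
instance : MonoidalCategoryStruct (Formed T) where
  tensorObj X Y := ⟨X.obj ⊗ Y.obj,
    res T (fst X.obj Y.obj) X.form + res T (snd X.obj Y.obj) Y.form⟩
  tensorHom f g :=
    { hom := f.hom ⊗ₘ g.hom
      w := (res_sum _ _ _).trans (by
        dsimp only
        rw [← f.w, ← g.w, res_res, res_res, tensorHom_fst, tensorHom_snd]) }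
  whiskerLeft X _ _ f :=
    { hom := X.obj ◁ f.hom
      w := (res_sum _ _ _).trans (by
        dsimp only
        rw [← f.w, res_res, whiskerLeft_fst, whiskerLeft_snd]) }
  whiskerRight f Y :=
    { hom := f.hom ▷ Y.obj
      w := (res_sum _ _ _).trans (by
        dsimp only
        rw [← f.w, res_res, whiskerRight_fst, whiskerRight_snd]) }
  tensorUnit := ⟨𝟙_ A, 0⟩
  associator X Y Z := isoMk (α_ X.obj Y.obj Z.obj)
    ((res_sum _ _ _).trans (by
      dsimp only
      rw [res_sum, res_sum, associator_hom_fst, Category.assoc, Category.assoc,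
        associator_hom_snd_fst, associator_hom_snd_snd, add_assoc]))
  leftUnitor X := isoMk (λ_ X.obj) (by simp [leftUnitor_hom])
  rightUnitor X := isoMk (ρ_ X.obj) (by simp [rightUnitor_hom])

variable (T) in
/-- The functor `π^T` strictly preserves the monoidal operations. -/
def inducingFunctorData : Monoidal.InducingFunctorData (forget T) where
  μIso _ _ := Iso.refl _
  εIso := Iso.refl _
  whiskerLeft_eq X _ _ f := by
    change X.obj ◁ f.hom = 𝟙 _ ≫ X.obj ◁ f.hom ≫ 𝟙 _
    simp
  whiskerRight_eq f X := by
    change f.hom ▷ X.obj = 𝟙 _ ≫ f.hom ▷ X.obj ≫ 𝟙 _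
    simp
  tensorHom_eq f g := by
    change f.hom ⊗ₘ g.hom = 𝟙 _ ≫ (f.hom ⊗ₘ g.hom) ≫ 𝟙 _
    simp
  associator_eq X Y Z := by
    change (α_ X.obj Y.obj Z.obj).hom = (𝟙 _ ≫ (𝟙 _ ⊗ₘ 𝟙 _)) ≫ (α_ X.obj Y.obj Z.obj).hom ≫
      (𝟙 _ ⊗ₘ 𝟙 _) ≫ 𝟙 _
    simp
  leftUnitor_eq X := by
    change (λ_ X.obj).hom = (𝟙 _ ≫ (𝟙 _ ⊗ₘ 𝟙 _)) ≫ (λ_ X.obj).hom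
    simp
  rightUnitor_eq X := by
    change (ρ_ X.obj).hom = (𝟙 _ ≫ (𝟙 _ ⊗ₘ 𝟙 _)) ≫ (ρ_ X.obj).hom
    simp

instance : MonoidalCategory (Formed T) := Monoidal.induced (forget T) (inducingFunctorData T)

instance : (forget T).Monoidal := Monoidal.fromInducedMonoidal (forget T) (inducingFunctorData T)

variable [BraidedCategory A]

instance : BraidedCategory (Formed T) :=
  .ofFaithful (forget T) (fun X Y => isoMk (β_ X.obj Y.obj)
      ((res_sum _ _ _).trans (by simp [add_comm])))
    (fun X Y => by
      change 𝟙 _ ≫ (β_ X.obj Y.obj).hom = (β_ X.obj Y.obj).hom ≫ 𝟙 _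
      simp)

instance : (forget T).Braided where
  braided X Y := by
    change 𝟙 _ ≫ (β_ X.obj Y.obj).hom = (β_ X.obj Y.obj).hom ≫ 𝟙 _
    simp

instance : SymmetricCategory (Formed T) := .ofFaithful (forget T)

end Monoidal

end Formed

/-! ### Nondegenerate forms: the category `H^T(A)` -/

section Hermitian

open CartesianMonoidalCategory

variable {A : Type w} [SmallCategory A] [Preadditive A] (𝔇 : Duality A) (ε : ℤˣ) (k : FormKind)

/-- The form `u ∈ T(X)` is nondegenerate if its image in `TD²(X) = A(X, D X)` is an
isomorphism. -/
def nondegenerate : ObjectProperty (Formed (𝔇.forms ε k)) :=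
  fun X => IsIso (C := A) (Y := 𝔇.D.obj (.op X.obj))
    ((𝔇.toTD2 ε k).app (.op X.obj) X.form : X.obj ⟶ 𝔇.D.obj (.op X.obj))

/-- The category `H^T(A)` of objects of `A` endowed with a nondegenerate form. -/
abbrev Herm : Type w := (nondegenerate 𝔇 ε k).FullSubcategory

lemma toTD2_res {X Y : A} (f : X ⟶ Y) (u : (𝔇.forms ε k).obj (.op Y)) :
    (𝔇.toTD2 ε k).app (.op X) (res _ f u) =
      f ≫ (show Y ⟶ 𝔇.D.obj (.op Y) from (𝔇.toTD2 ε k).app (.op Y) u) ≫ 𝔇.D.map f.op :=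
  ConcreteCategory.congr_hom ((𝔇.toTD2 ε k).naturality f.op) u

variable [CartesianMonoidalCategory A]

/-- The unit of the direct sum is a zero object. -/
instance : UnitInitial A where
  isInitial := IsInitial.ofUniqueHom (fun _ => 0) fun X f => by
    rw [← Category.id_comp f, isTerminalTensorUnit.hom_ext (𝟙 (𝟙_ A)) 0, zero_comp]

lemma subsingleton_forms : Subsingleton ((𝔇.forms ε k).obj (.op (𝟙_ A))) := by
  have : Subsingleton (𝔇.TD2.obj (.op (𝟙_ A))) :=
    ⟨fun u v => (UnitInitial.isInitial (M := A)).hom_ext (Y := 𝔇.D.obj (.op (𝟙_ A))) u v⟩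
  match k with
  | .sym =>
    have : Function.Surjective ((cokernel.π (𝔇.antinorm ε)).app (.op (𝟙_ A))) :=
      (AddCommGrpCat.epi_iff_surjective _).1 inferInstance
    exact this.subsingleton
  | .symBar =>
    have : Function.Injective ((image.ι (𝔇.norm ε)).app (.op (𝟙_ A))) :=
      (AddCommGrpCat.mono_iff_injective _).1 inferInstance
    exact this.subsingleton

instance : (nondegenerate 𝔇 ε k).IsMonoidal where
  prop_unit := by
    have h : IsZero (𝟙_ A) := by
      rw [IsZero.iff_id_eq_zero]
      exact isTerminalTensorUnit.hom_ext _ _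
    have h' : IsZero (𝔇.D.obj (.op (𝟙_ A))) := by
      rw [IsZero.iff_id_eq_zero, ← 𝔇.D.map_id, ← op_id, h.eq_of_src (𝟙 (𝟙_ A)) 0]
      have := 𝔇.map_add (0 : 𝟙_ A ⟶ 𝟙_ A) 0
      rwa [add_zero, left_eq_add] at this
    exact ⟨0, h.eq_of_src _ _, h'.eq_of_src _ _⟩
  prop_tensor X Y hX hY := by
    let a : X.obj ⟶ 𝔇.D.obj (.op X.obj) := (𝔇.toTD2 ε k).app (.op X.obj) X.form
    let b : Y.obj ⟶ 𝔇.D.obj (.op Y.obj) := (𝔇.toTD2 ε k).app (.op Y.obj) Y.form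
    have ha : IsIso a := hX
    have hb : IsIso b := hY
    have hu : ((𝔇.toTD2 ε k).app (.op (X ⊗ Y).obj) (X ⊗ Y).form :
        X.obj ⊗ Y.obj ⟶ 𝔇.D.obj (.op (X.obj ⊗ Y.obj))) =
        fst X.obj Y.obj ≫ a ≫ 𝔇.D.map (fst X.obj Y.obj).op +
          snd X.obj Y.obj ≫ b ≫ 𝔇.D.map (snd X.obj Y.obj).op :=
      (_root_.map_add ((𝔇.toTD2 ε k).app (.op (X.obj ⊗ Y.obj))).hom _ _).trans
        (congrArg₂ _ (toTD2_res 𝔇 ε k (fst X.obj Y.obj) X.form)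
          (toTD2_res 𝔇 ε k (snd X.obj Y.obj) Y.form))
    let i : X.obj ⟶ X.obj ⊗ Y.obj := lift (𝟙 _) 0
    let j : Y.obj ⟶ X.obj ⊗ Y.obj := lift 0 (𝟙 _)
    have hi : i ≫ fst _ _ = 𝟙 _ := lift_fst _ _
    have hi' : i ≫ snd _ _ = 0 := lift_snd _ _
    have hj : j ≫ fst _ _ = 0 := lift_fst _ _
    have hj' : j ≫ snd _ _ = 𝟙 _ := lift_snd _ _
    have hij : fst _ _ ≫ i + snd _ _ ≫ j = 𝟙 (X.obj ⊗ Y.obj) := by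
      ext <;> simp [hi, hi', hj, hj']
    have h0 (P Q : A) : 𝔇.D.map (0 : P ⟶ Q).op = 0 := by
      have := 𝔇.map_add (0 : P ⟶ Q) 0
      rwa [add_zero, left_eq_add] at this
    have ki : 𝔇.D.map (fst X.obj Y.obj).op ≫ 𝔇.D.map i.op = 𝟙 _ := by
      rw [← 𝔇.D.map_comp, ← op_comp, hi, op_id, 𝔇.D.map_id]
    have ki' : 𝔇.D.map (snd X.obj Y.obj).op ≫ 𝔇.D.map i.op = 0 := by
      rw [← 𝔇.D.map_comp, ← op_comp, hi', h0]
    have kj : 𝔇.D.map (fst X.obj Y.obj).op ≫ 𝔇.D.map j.op = 0 := by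
      rw [← 𝔇.D.map_comp, ← op_comp, hj, h0]
    have kj' : 𝔇.D.map (snd X.obj Y.obj).op ≫ 𝔇.D.map j.op = 𝟙 _ := by
      rw [← 𝔇.D.map_comp, ← op_comp, hj', op_id, 𝔇.D.map_id]
    have kij : 𝔇.D.map i.op ≫ 𝔇.D.map (fst X.obj Y.obj).op +
        𝔇.D.map j.op ≫ 𝔇.D.map (snd X.obj Y.obj).op = 𝟙 _ := by
      rw [← 𝔇.D.map_comp, ← 𝔇.D.map_comp, ← op_comp, ← op_comp, ← 𝔇.map_add, hij, op_id,
        𝔇.D.map_id]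
    change IsIso ((𝔇.toTD2 ε k).app (.op (X ⊗ Y).obj) (X ⊗ Y).form :
        X.obj ⊗ Y.obj ⟶ 𝔇.D.obj (.op (X.obj ⊗ Y.obj)))
    rw [hu]
    refine ⟨𝔇.D.map i.op ≫ inv a ≫ i + 𝔇.D.map j.op ≫ inv b ≫ j, ?_, ?_⟩
    · simp [reassoc_of% ki, reassoc_of% ki', reassoc_of% kj, reassoc_of% kj', hij]
    · simp [reassoc_of% hi, reassoc_of% hi', reassoc_of% hj, reassoc_of% hj', kij]

variable [BraidedCategory A]

noncomputable instance : UnitInitial (Herm 𝔇 ε k) where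
  isInitial := IsInitial.ofUniqueHom
    (fun X => ObjectProperty.homMk { hom := UnitInitial.isInitial.to _, w := (subsingleton_forms 𝔇 ε k).elim _ _ })
    fun X f => by
      ext
      apply UnitInitial.isInitial.hom_ext

/-- The forgetful functor `π^T : H^T(A) ⥤ A`. -/
noncomputable abbrev Herm.forget : Herm 𝔇 ε k ⥤ A := (nondegenerate 𝔇 ε k).ι ⋙ Formed.forget _

end Hermitian

end WeakPoly

/-! Degrees are handled on actual functors: `PolF (n + 1)` is the class of functors whose image in
the stable category lies in `Pol n`. It is a Serre class (`polF_isSerreClass_and`), by the snake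
lemma and because kernels of `i_x` are stably null. This gives both closure properties. Restriction
along `π^T` commutes with differences, which gives the generators.

For minimality, let `F` be in `PolF (m + 1)` and let `F ⟶ (π^T)^* Lan F` be the unit of the left Kan
extension along `π^T`. Its kernel and cokernel lie in `PolF m`, and `Lan F` is polynomial on `A` of
the same degree as `F`. Induction on `m` then puts the image of the unit in `C`, as the kernel of an
epimorphism, and afterwards `F`, as an extension.

The cokernel is easy (`polF_cokernel_hermLanUnit`): a morphism `g : z ⟶ y` of `A` becomes the last
component of the form-preserving morphism `(1, g, g) : z ⟶ (z ⊕ ȳ) ⊕ y`, where `ȳ` carries the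
opposite form. Hence the functors `δ_t F` jointly cover the cokernel.

The kernel is the heart of the matter. By `polF_of_sumCocone` it suffices that natural families `c_t
: F(t ⊕ Y) ⟶ W`, with `Y = y₁ ⊕ ⋯ ⊕ yₙ ⊕ v`, which vanish when some `yᵢ` is omitted, factor through
the unit. This follows from `map_comp_app_eq`: composing `c` with a morphism to `t ⊕ Y` only
remembers the component in `Y`. Adding isotropic components makes two morphisms with the same
`Y`-component comparable, so one needs `c` to be unchanged by the graph of an isotropic morphism `κ`
(`map_graph_comp_app`).

That invariance is proved by induction on `n`, after replacing `κ` by a morphism that ignores `y₁`.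
If `κ` is defined on a sum with an extra summand `t`, vanishing in degree `n + 1` shows that its
part on `t` is irrelevant (`shift_shift_restrict_graph_eq`). A reflection on four copies of `y`, one
with the opposite form, together with polynomiality, writes any `c` as a sum of two families in
which `y` is also recorded in such an extra summand (`exists_eq_add`). -/

set_option linter.unusedSectionVars false

namespace WeakPoly

/-! ### Exactness of the difference functors and the Serre classes of polynomial functors -/

section Difference

variable {M : Type w} [SmallCategory M] [MonoidalCategory M] [UnitInitial M]
  {B : Type u} [Category.{w} B] [Abelian B]

/-- The natural transformation `i_x`. -/
@[simps]
def iotaNat (x : M) : 𝟭 (M ⥤ B) ⟶ tau x where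
  app F := iota x F
  naturality _ _ f := iota_naturality x f

/-- The functor `κ_x`. -/
@[simps]
noncomputable def kappaFunctor (x : M) : (M ⥤ B) ⥤ (M ⥤ B) where
  obj F := kernel (iota x F)
  map f := kernel.map _ _ f ((tau x).map f) (iota_naturality x f).symm
  map_id F := by rw [← cancel_mono (kernel.ι _)]; simp
  map_comp f g := by rw [← cancel_mono (kernel.ι _)]; simp

/-- The inclusion `κ_x ⟶ Id`. -/
@[simps]
noncomputable def kappaι (x : M) : kappaFunctor x ⟶ 𝟭 (M ⥤ B) where
  app F := kernel.ι (iota x F)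
  naturality _ _ _ := kernel.lift_ι _ _ _

instance (x : M) (F : M ⥤ B) : Mono ((kappaι x).app F) :=
  inferInstanceAs (Mono (kernel.ι (iota x F)))

/-- The projection `τ_x ⟶ δ_x`. -/
@[simps]
noncomputable def deltaπ (x : M) : tau (B := B) x ⟶ delta x where
  app F := cokernel.π (iota x F)
  naturality _ _ _ := (cokernel.π_desc _ _ _).symm

instance (x : M) (F : M ⥤ B) : Epi ((deltaπ x).app F) :=
  inferInstanceAs (Epi (cokernel.π (iota x F)))

lemma iota_deltaπ (x : M) (F : M ⥤ B) : iota x F ≫ (deltaπ x).app F = 0 :=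
  cokernel.condition _

instance (x : M) : (kappaFunctor (B := B) x).PreservesZeroMorphisms where
  map_zero F G := by
    rw [← cancel_mono ((kappaι x).app G), (kappaι x).naturality, Functor.map_zero, zero_comp,
      comp_zero]

instance (x : M) : (delta (B := B) x).PreservesZeroMorphisms where
  map_zero F G := by
    rw [← cancel_epi ((deltaπ x).app F), ← (deltaπ x).naturality, Functor.map_zero, zero_comp,
      comp_zero]

/-- The snake diagram given by `i_x` on a short exact sequence. -/
@[simps]
noncomputable def deltaSnake (x : M) {S : ShortComplex (M ⥤ B)} (hS : S.ShortExact) :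
    ShortComplex.SnakeInput (M ⥤ B) where
  L₀ := S.map (kappaFunctor x)
  L₁ := S.map (𝟭 _)
  L₂ := S.map (tau x)
  L₃ := S.map (delta x)
  v₀₁ := S.mapNatTrans (kappaι x)
  v₁₂ := S.mapNatTrans (iotaNat x)
  v₂₃ := S.mapNatTrans (deltaπ x)
  w₀₂ := by ext1 <;> exact kernel.condition _
  w₁₃ := by ext1 <;> exact cokernel.condition _
  h₀ := by
    apply ShortComplex.isLimitOfIsLimitπ
    all_goals exact (KernelFork.isLimitMapConeEquiv _ _).symm (kernelIsKernel _)
  h₃ := by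
    apply ShortComplex.isColimitOfIsColimitπ
    all_goals exact (CokernelCofork.isColimitMapCoconeEquiv _ _).symm (cokernelIsCokernel _)
  L₁_exact := hS.exact
  L₂_exact := (hS.map_of_exact (tau x)).exact
  epi_L₁_g := hS.epi_g
  mono_L₂_f := (hS.map_of_exact (tau x)).mono_f

instance (x : M) {F G : M ⥤ B} (f : F ⟶ G) [Epi f] : Epi ((delta x).map f) := by
  have : Epi ((deltaπ x).app F ≫ (delta x).map f) := by
    rw [← (deltaπ x).naturality]
    exact epi_comp _ _
  exact epi_of_epi ((deltaπ x).app F) _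

lemma delta_exact (x : M) {S : ShortComplex (M ⥤ B)} (hS : S.ShortExact) :
    (S.map (delta x)).Exact := (deltaSnake x hS).L₃_exact

lemma shortExact_of_mono {C : Type*} [Category* C] [Abelian C] {X Y : C} (f : X ⟶ Y) [Mono f] :
    (ShortComplex.mk f (cokernel.π f) (cokernel.condition f)).ShortExact where
  exact := ShortComplex.exact_of_g_is_cokernel _ (cokernelIsCokernel f)

variable [IsGrothendieckAbelian.{w} B]

/-- The map `i_x` vanishes on its own kernel, by naturality and because `τ_x` preserves
monomorphisms; so `κ_x` of this functor is everything. -/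
lemma stablyNull_kernel_iota (x : M) (F : M ⥤ B) : stablyNull M B (kernel (iota x F)) := by
  rw [stablyNull_iff']
  intro Z f hf
  have := hf x (𝟙 _) (by
    rw [← cancel_mono ((tau x).map (kernel.ι (iota x F))), Category.id_comp, ← iota_naturality,
      kernel.condition, zero_comp])
  simpa using this

/-- Functors whose iterated differences are stably null. The functors which satisfy
`PolF (n + 1)` are those whose image in the stable category is polynomial of degree at most `n`. -/
def PolF : ℕ → ObjectProperty (M ⥤ B)
  | 0 => stablyNull M B
  | n + 1 => fun F => ∀ x : M, PolF n ((delta x).obj F)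

lemma polF_succ_iff (n : ℕ) (F : M ⥤ B) :
    PolF (n + 1) F ↔ ∀ x : M, PolF n ((delta x).obj F) := Iff.rfl

lemma prop_of_prop_kernel {C : Type*} [Category* C] [Abelian C] (P : ObjectProperty C)
    [P.IsSerreClass] {X Y : C} (f : X ⟶ Y) (hf : P (kernel f)) (hY : P Y) : P X :=
  P.prop_X₂_of_exact (ShortComplex.exact_of_f_is_kernel
    (ShortComplex.mk _ _ (kernel.condition f)) (kernelIsKernel _)) hf hY

/-- By the snake lemma this kernel is a quotient of `κ_x(H)`. Thus `δ_x`, which is only right exact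
on functors, becomes exact in the stable category. -/
lemma stablyNull_kernel_delta_map_of_shortExact (x : M) {F G H : M ⥤ B} (f : F ⟶ G) (g : G ⟶ H)
    (w : f ≫ g = 0) (hS : (ShortComplex.mk f g w).ShortExact) :
    stablyNull M B (kernel ((delta x).map f)) := by
  have h := (deltaSnake x hS).L₂'_exact
  rw [ShortComplex.exact_iff_epi_kernel_lift] at h
  change Epi (kernel.lift ((delta x).map f) (deltaSnake x hS).δ _) at h
  have h' : stablyNull M B (deltaSnake x hS).L₀.X₃ := stablyNull_kernel_iota x H
  exact ObjectProperty.prop_of_epi _ (kernel.lift ((delta x).map f) (deltaSnake x hS).δ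
    (deltaSnake x hS).δ_L₃_f) h'

lemma stablyNull_kernel_delta_map (x : M) {F G : M ⥤ B} (f : F ⟶ G) [Mono f] :
    stablyNull M B (kernel ((delta x).map f)) :=
  stablyNull_kernel_delta_map_of_shortExact x f _ _ (shortExact_of_mono f)

end Difference

section Symmetric

variable {M : Type w} [SmallCategory M] [MonoidalCategory M] [SymmetricCategory M] [UnitInitial M]
  {B : Type u} [Category.{w} B] [Abelian B] [IsGrothendieckAbelian.{w} B]

/-- The two assertions are proved together: for a subobject, `δ_x` of the inclusion has a stably
null kernel, and this must be known to lie in `PolF n`. -/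
lemma polF_isSerreClass_and (n : ℕ) : (PolF (M := M) (B := B) n).IsSerreClass ∧
    stablyNull M B ≤ PolF n := by
  induction n with
  | zero => exact ⟨inferInstanceAs (stablyNull M B).IsSerreClass, le_refl _⟩
  | succ n ih =>
    obtain ⟨_, ih'⟩ := ih
    have hnull : stablyNull M B ≤ PolF (n + 1) := fun F hF x =>
      ih' _ ((stablyNull M B).prop_of_epi ((deltaπ x).app F) (stablyNull_tau x hF))
    have h₃ : (PolF (M := M) (B := B) (n + 1)).IsClosedUnderQuotients := by
      refine ⟨fun {F G} f _ hF => ?_⟩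
      rw [polF_succ_iff] at hF ⊢
      intro x
      exact (PolF n).prop_of_epi ((delta x).map f) (hF x)
    have h₁ : (PolF (M := M) (B := B) (n + 1)).ContainsZero := by
      obtain ⟨F, hF, hF'⟩ := (stablyNull M B).exists_prop_of_containsZero
      exact ⟨F, hF, hnull _ hF'⟩
    have h₂ : (PolF (M := M) (B := B) (n + 1)).IsClosedUnderSubobjects := by
      refine ⟨fun {F G} f _ hG => ?_⟩
      rw [polF_succ_iff] at hG ⊢
      intro x
      have h : stablyNull M B (kernel ((delta x).map f)) :=
        stablyNull_kernel_delta_map x f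
      exact prop_of_prop_kernel (PolF n) ((delta x).map f) (ih' _ h) (hG x)
    have h₄ : (PolF (M := M) (B := B) (n + 1)).IsClosedUnderExtensions := by
      refine ⟨fun {S} hS h₁ h₃ => ?_⟩
      rw [polF_succ_iff] at h₁ h₃ ⊢
      intro x
      exact (PolF n).prop_X₂_of_exact (delta_exact x hS) (h₁ x) (h₃ x)
    exact ⟨{}, hnull⟩

instance (n : ℕ) : (PolF (M := M) (B := B) n).IsSerreClass := (polF_isSerreClass_and n).1

lemma stablyNull_le_polF (n : ℕ) : stablyNull M B ≤ PolF n := (polF_isSerreClass_and n).2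

lemma polF_le_succ (n : ℕ) : PolF (M := M) (B := B) n ≤ PolF (n + 1) := by
  induction n with
  | zero => exact stablyNull_le_polF 1
  | succ n ih => exact fun F hF x => ih _ (hF x)

lemma polF_le {m n : ℕ} (h : m ≤ n) : PolF (M := M) (B := B) m ≤ PolF n :=
  monotone_nat_of_le_succ polF_le_succ h

end Symmetric

/-! ### Passage to the stable category -/

section Stable

variable {M : Type w} [SmallCategory M] [MonoidalCategory M] [SymmetricCategory M] [UnitInitial M]
  {B : Type u} [Category.{w} B] [Abelian B] [IsGrothendieckAbelian.{w} B]

lemma isZero_proj_iff (F : M ⥤ B) : IsZero ((proj M B).obj F) ↔ stablyNull M B F :=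
  ObjectProperty.SerreClassLocalization.isZero_obj_iff (proj M B) (stablyNull M B) F

/-- The compatibility of the difference functors with the projection to the stable category. -/
noncomputable def stDeltaProjIso (x : M) (F : M ⥤ B) :
    (stDelta x).obj ((proj M B).obj F) ≅ (proj M B).obj ((delta x).obj F) :=
  (Localization.fac (delta x ⋙ proj M B) (delta_proj_inverts x) (proj M B)).app F

lemma pol_of_iso (n : ℕ) {X Y : St M B} (e : X ≅ Y) (hX : Pol M B n X) : Pol M B n Y := by
  induction n generalizing X Y with
  | zero => exact fun x => (hX x).of_iso ((stDelta x).mapIso e).symm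
  | succ n ih => exact fun x => ih ((stDelta x).mapIso e) (hX x)

lemma pol_iso_iff (n : ℕ) {X Y : St M B} (e : X ≅ Y) : Pol M B n X ↔ Pol M B n Y :=
  ⟨pol_of_iso n e, pol_of_iso n e.symm⟩

/-- The index is shifted because `PolF 0` plays the role of the zero objects, that is, of negative
degree. -/
lemma pol_proj_iff (n : ℕ) (F : M ⥤ B) : Pol M B n ((proj M B).obj F) ↔ PolF (n + 1) F := by
  induction n generalizing F with
  | zero =>
    exact forall_congr' fun x => (stDeltaProjIso x F).isZero_iff.trans (isZero_proj_iff _)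
  | succ n ih =>
    exact forall_congr' fun x => (pol_iso_iff n (stDeltaProjIso x F)).trans (ih _)

/-- A short exact sequence of the stable category comes from a short exact sequence of functors. -/
lemma exists_shortExact_lift (S : ShortComplex (St M B)) (hS : S.ShortExact) :
    ∃ T : ShortComplex (M ⥤ B), T.ShortExact ∧ Nonempty ((proj M B).obj T.X₁ ≅ S.X₁) ∧
      Nonempty ((proj M B).obj T.X₂ ≅ S.X₂) ∧ Nonempty ((proj M B).obj T.X₃ ≅ S.X₃) := by
  -- An epimorphism of a Serre quotient is, up to isomorphism of arrows, the image of an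
  -- epimorphism; the kernel of the latter gives the rest of the sequence.
  obtain ⟨X, Y, f, _, ⟨e⟩⟩ := (ObjectProperty.SerreClassLocalization.epi_iff (proj M B)
    (stablyNull M B) S.g).1 hS.epi_g
  have := ObjectProperty.SerreClassLocalization.preservesKernel (proj M B) (stablyNull M B) f
  let T : ShortComplex (M ⥤ B) := ShortComplex.mk (kernel.ι f) f (kernel.condition f)
  have h₁ : IsLimit (KernelFork.ofι ((proj M B).map (kernel.ι f))
      (by rw [← Functor.map_comp, kernel.condition, Functor.map_zero])) :=
    (KernelFork.isLimitMapConeEquiv (KernelFork.ofι (kernel.ι f) (kernel.condition f))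
      (proj M B)).1
      (isLimitOfPreserves (proj M B) (c := KernelFork.ofι (kernel.ι f) (kernel.condition f))
        (kernelIsKernel f))
  let e₂ : (proj M B).obj X ≅ S.X₂ := Arrow.leftFunc.mapIso e
  let e₃ : (proj M B).obj Y ≅ S.X₃ := Arrow.rightFunc.mapIso e
  refine ⟨T, { exact := T.exact_of_f_is_kernel (kernelIsKernel f)
               mono_f := inferInstanceAs (Mono (kernel.ι f))
               epi_g := inferInstanceAs (Epi f) }, ⟨?_⟩, ⟨e₂⟩, ⟨e₃⟩⟩
  have : Balanced (St M B) := by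
    let := ObjectProperty.SerreClassLocalization.abelian (proj M B) (stablyNull M B)
    infer_instance
  exact KernelFork.mapIsoOfIsLimit h₁ hS.fIsKernel e

lemma pol_prop_X₁ (n : ℕ) (S : ShortComplex (St M B)) (hS : S.ShortExact) (h₂ : Pol M B n S.X₂) :
    Pol M B n S.X₁ := by
  obtain ⟨T, hT, ⟨e₁⟩, ⟨e₂⟩, -⟩ := exists_shortExact_lift S hS
  rw [← pol_iso_iff n e₁, pol_proj_iff]
  rw [← pol_iso_iff n e₂, pol_proj_iff] at h₂
  exact (PolF (n + 1)).prop_X₁_of_shortExact hT h₂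

lemma pol_prop_X₂ (n : ℕ) (S : ShortComplex (St M B)) (hS : S.ShortExact) (h₁ : Pol M B n S.X₁)
    (h₃ : Pol M B n S.X₃) : Pol M B n S.X₂ := by
  obtain ⟨T, hT, ⟨e₁⟩, ⟨e₂⟩, ⟨e₃⟩⟩ := exists_shortExact_lift S hS
  rw [← pol_iso_iff n e₂, pol_proj_iff]
  rw [← pol_iso_iff n e₁, pol_proj_iff] at h₁
  rw [← pol_iso_iff n e₃, pol_proj_iff] at h₃
  exact (PolF (n + 1)).prop_X₂_of_shortExact hT h₁ h₃

lemma proj_shortExact {T : ShortComplex (M ⥤ B)} (hT : T.ShortExact) :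
    ∃ S : ShortComplex (St M B), S.ShortExact ∧ S.X₁ = (proj M B).obj T.X₁ ∧
      S.X₂ = (proj M B).obj T.X₂ ∧ S.X₃ = (proj M B).obj T.X₃ := by
  have := ObjectProperty.SerreClassLocalization.preservesKernel (proj M B) (stablyNull M B) T.g
  have := ObjectProperty.SerreClassLocalization.preservesMonomorphisms (proj M B) (stablyNull M B)
  have := ObjectProperty.SerreClassLocalization.preservesEpimorphisms (proj M B) (stablyNull M B)
  have := hT.mono_f
  have := hT.epi_g
  have := ObjectProperty.SerreClassLocalization.preservesCokernel (proj M B) (stablyNull M B) T.f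
  have := ObjectProperty.SerreClassLocalization.preservesFiniteLimits (proj M B) (stablyNull M B)
  have := ObjectProperty.SerreClassLocalization.preservesFiniteColimits (proj M B) (stablyNull M B)
  exact ⟨T.map (proj M B), hT.map_of_exact _, rfl, rfl, rfl⟩

/-- Pointwise jointly epimorphic families. -/
def JointlyEpi {J : Type*} {G : J → (M ⥤ B)} {Q : M ⥤ B} (m : ∀ j, G j ⟶ Q) : Prop :=
  ∀ (z : M) ⦃W : B⦄ (f : Q.obj z ⟶ W), (∀ j, (m j).app z ≫ f = 0) → f = 0

/-- Pointwise joint surjectivity passes to the differences, `δ_x` being a quotient of `τ_x`; so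
everything reduces to stably null functors. -/
lemma polF_of_jointlyEpi {J : Type*} (n : ℕ) {G : J → (M ⥤ B)} {Q : M ⥤ B} (m : ∀ j, G j ⟶ Q)
    (hm : JointlyEpi m) (hG : ∀ j, PolF n (G j)) : PolF n Q := by
  induction n generalizing G Q with
  | zero =>
    refine (stablyNull_iff' Q).2 fun Z f hf => ?_
    ext z
    refine hm z _ fun j => ?_
    have h : m j ≫ f = 0 := by
      refine (stablyNull_iff' (G j)).1 (hG j) _ fun x W p hp => ?_
      rw [← Category.assoc]
      apply hf x
      rw [Category.assoc, iota_naturality, reassoc_of% hp, zero_comp]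
    exact NatTrans.congr_app h z
  | succ n ih =>
    intro x
    refine ih (fun j => (delta x).map (m j)) (fun z W f hf => ?_) fun j => hG j x
    rw [← cancel_epi (((deltaπ x).app Q).app z), comp_zero]
    refine hm (x ⊗ z) _ fun j => ?_
    have h := NatTrans.congr_app ((deltaπ x).naturality (m j)) z
    have h' : (m j).app (x ⊗ z) ≫ ((deltaπ x).app Q).app z =
      ((deltaπ x).app (G j)).app z ≫ ((delta x).map (m j)).app z := h
    rw [reassoc_of% h', hf, comp_zero]

end Stable

/-! ### Natural families on `F(t ⊕ Y)` that vanish on omissions -/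

section Vanishing

variable {M : Type w} [SmallCategory M] [MonoidalCategory M]

/-- The omission morphisms to `y ⊕ Y`: either `y` is omitted, or a part of `Y` is omitted according
to `S`. -/
inductive ConsOmits [UnitInitial M] (y : M) {Y : M} (S : ∀ ⦃Y' : M⦄, (Y' ⟶ Y) → Prop) :
    ∀ ⦃Y' : M⦄, (Y' ⟶ y ⊗ Y) → Prop
  | head : ConsOmits y S (unitTo y Y)
  | tail ⦃Y' : M⦄ (a : Y' ⟶ Y) (h : S a) : ConsOmits y S (y ◁ a)

/-- `IsSum n Y S` means that `Y` is of the form `y₁ ⊕ (y₂ ⊕ ⋯ ⊕ (yₙ ⊕ v))` and that `S` consists of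
the morphisms to `Y` which omit one of the `yᵢ`. -/
inductive IsSum [UnitInitial M] : ℕ → ∀ Y : M, (∀ ⦃Y' : M⦄, (Y' ⟶ Y) → Prop) → Prop
  | base (v : M) : IsSum 0 v (fun _ _ => False)
  | cons (n : ℕ) (y Y : M) (S : ∀ ⦃Y' : M⦄, (Y' ⟶ Y) → Prop) (h : IsSum n Y S) :
      IsSum (n + 1) (y ⊗ Y) (ConsOmits y S)

variable {B : Type u} [Category.{w} B]

/-- Natural families of morphisms `F(t ⊕ Y) ⟶ W`. -/
@[ext]
structure SumCocone (F : M ⥤ B) (Y : M) (W : B) where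
  /-- The morphism `F(t ⊕ Y) ⟶ W`. -/
  app (t : M) : F.obj (t ⊗ Y) ⟶ W
  w {t t' : M} (h : t ⟶ t') : F.map (h ▷ Y) ≫ app t' = app t

instance [Preadditive B] (F : M ⥤ B) (Y : M) (W : B) : Sub (SumCocone F Y W) where
  sub c c' :=
    { app := fun t => c.app t - c'.app t
      w := fun h => by rw [Preadditive.comp_sub, c.w, c'.w] }

lemma SumCocone.sub_app [Preadditive B] {F : M ⥤ B} {Y : M} {W : B} (c c' : SumCocone F Y W)
    (t : M) : (c - c').app t = c.app t - c'.app t := rfl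

/-- The morphisms `F(t ⊕ Y) ⟶ W` vanish on `F(t ⊕ Y')` for all `Y' ⟶ Y` in `S`. -/
def SumCocone.Kills [HasZeroMorphisms B] {F : M ⥤ B} {Y : M} {W : B}
    (c : SumCocone F Y W) (S : ∀ ⦃Y' : M⦄, (Y' ⟶ Y) → Prop) : Prop :=
  ∀ ⦃Y' : M⦄ (a : Y' ⟶ Y), S a → ∀ t : M, F.map (t ◁ a) ≫ c.app t = 0

section

variable [SymmetricCategory M]

/-- The isomorphism `y ⊕ (t ⊕ Y) ≅ t ⊕ (y ⊕ Y)`. -/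
def tensorSwap (y t Y : M) : y ⊗ (t ⊗ Y) ≅ t ⊗ (y ⊗ Y) :=
  (α_ y t Y).symm ≪≫ whiskerRightIso (β_ y t) Y ≪≫ α_ t y Y

lemma unitTo_tensorSwap [UnitInitial M] (y t Y : M) :
    unitTo y (t ⊗ Y) ≫ (tensorSwap y t Y).hom = t ◁ unitTo y Y :=
  (whiskerLeft_unitTo t y Y).symm

lemma tensorSwap_naturality_middle (y : M) {t t' : M} (h : t ⟶ t') (Y : M) :
    y ◁ (h ▷ Y) ≫ (tensorSwap y t' Y).hom = (tensorSwap y t Y).hom ≫ h ▷ (y ⊗ Y) := by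
  simp only [tensorSwap, Iso.trans_hom, Iso.symm_hom, whiskerRightIso_hom, Category.assoc,
    associator_inv_naturality_middle_assoc, ← comp_whiskerRight_assoc,
    BraidedCategory.braiding_naturality_right]
  simp

lemma tensorSwap_naturality_right (y t : M) {Y Y' : M} (a : Y ⟶ Y') :
    y ◁ (t ◁ a) ≫ (tensorSwap y t Y').hom = (tensorSwap y t Y).hom ≫ t ◁ (y ◁ a) := by
  simp only [tensorSwap, Iso.trans_hom, Iso.symm_hom, whiskerRightIso_hom, Category.assoc,
    associator_inv_naturality_right_assoc]
  rw [whisker_exchange_assoc]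
  simp

end

variable [Abelian B] [UnitInitial M]

lemma exists_desc_of_preserves {C D : Type*} [Category* C] [Category* D] [Abelian C] [Abelian D]
    (Φ : C ⥤ D) [PreservesFiniteColimits Φ] {X Y : C} (f : X ⟶ Y) {W : D} (m : Φ.obj Y ⟶ W)
    (hm : Φ.map f ≫ m = 0) : ∃ d : Φ.obj (cokernel f) ⟶ W, Φ.map (cokernel.π f) ≫ d = m := by
  have : Φ.PreservesZeroMorphisms := Functor.preservesZeroMorphisms_of_preserves_initial_object
  let h := (CokernelCofork.isColimitMapCoconeEquiv (CokernelCofork.ofπ (cokernel.π f)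
    (cokernel.condition f)) Φ).1 (isColimitOfPreserves Φ (cokernelIsCokernel f))
  exact ⟨_, (CokernelCofork.IsColimit.desc' h m hm).2⟩

/-- A family that vanishes when `y` is omitted factors through the cokernel of `i_y`. This trades a
summand for a difference functor, the basis of the inductions on `n`. -/
lemma exists_delta_desc [SymmetricCategory M] {F : M ⥤ B} {y Y : M} {W : B}
    (c : SumCocone F (y ⊗ Y) W) (hc : ∀ t : M, F.map (t ◁ unitTo y Y) ≫ c.app t = 0) :
    ∃ d : SumCocone ((delta y).obj F) Y W, ∀ t : M,
      ((deltaπ y).app F).app (t ⊗ Y) ≫ d.app t = F.map (tensorSwap y t Y).hom ≫ c.app t := by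
  have h (t : M) : ∃ d : ((delta y).obj F).obj (t ⊗ Y) ⟶ W,
      ((deltaπ y).app F).app (t ⊗ Y) ≫ d = F.map (tensorSwap y t Y).hom ≫ c.app t := by
    refine exists_desc_of_preserves ((evaluation M B).obj (t ⊗ Y)) (iota y F)
      (F.map (tensorSwap y t Y).hom ≫ c.app t) ?_
    change F.map (unitTo y (t ⊗ Y)) ≫ _ = 0
    rw [← F.map_comp_assoc, unitTo_tensorSwap, hc]
  choose d hd using h
  refine ⟨⟨d, fun {t t'} h => ?_⟩, hd⟩
  rw [← cancel_epi (((deltaπ y).app F).app (t ⊗ Y)), hd]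
  have h' : F.map (y ◁ (h ▷ Y)) ≫ ((deltaπ y).app F).app (t' ⊗ Y) =
    ((deltaπ y).app F).app (t ⊗ Y) ≫ ((delta y).obj F).map (h ▷ Y) :=
    ((deltaπ y).app F).naturality (h ▷ Y)
  rw [← reassoc_of% h', hd, ← F.map_comp_assoc, tensorSwap_naturality_middle, F.map_comp_assoc, c.w]

lemma kills_of_desc [SymmetricCategory M] {F : M ⥤ B} {y Y : M}
    {S : ∀ ⦃Y' : M⦄, (Y' ⟶ Y) → Prop} {W : B}
    (c : SumCocone F (y ⊗ Y) W) (hc : c.Kills (ConsOmits y S))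
    (d : SumCocone ((delta y).obj F) Y W) (hd : ∀ t : M,
      ((deltaπ y).app F).app (t ⊗ Y) ≫ d.app t = F.map (tensorSwap y t Y).hom ≫ c.app t) :
    d.Kills S := by
  intro Y' a ha t
  rw [← cancel_epi (((deltaπ y).app F).app (t ⊗ Y')), comp_zero]
  have h' : F.map (y ◁ (t ◁ a)) ≫ ((deltaπ y).app F).app (t ⊗ Y) =
    ((deltaπ y).app F).app (t ⊗ Y') ≫ ((delta y).obj F).map (t ◁ a) :=
    ((deltaπ y).app F).naturality (t ◁ a)
  rw [← reassoc_of% h', hd, ← F.map_comp_assoc, tensorSwap_naturality_right, F.map_comp_assoc,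
    hc _ (.tail a ha), comp_zero]

variable [SymmetricCategory M] [IsGrothendieckAbelian.{w} B]

/-- A morphism to a constant functor factors through every `i_x`, hence vanishes on every `κ_x(F)`.
-/
lemma hom_const_eq_zero {F : M ⥤ B} (hF : stablyNull M B F) {W : B}
    (c : F ⟶ (Functor.const M).obj W) : c = 0 := by
  refine (stablyNull_iff F).1 hF c fun x => ?_
  have h : c = iota x F ≫ (tau x).map c := by
    ext z
    have := c.naturality (unitTo x z)
    exact (this.trans (Category.comp_id (c.app z))).symm
  rw [h, kernel.condition_assoc, zero_comp]

/-- This is the cross-effect description of polynomiality: descending through one difference for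
each omitted summand leaves a stably null functor, translated by `v`, with a morphism to a constant
one. -/
lemma SumCocone.app_eq_zero {n : ℕ} {F : M ⥤ B} (hF : PolF n F) {Y : M}
    {S : ∀ ⦃Y' : M⦄, (Y' ⟶ Y) → Prop} (hY : IsSum n Y S) {W : B}
    (c : SumCocone F Y W) (hc : c.Kills S) (t : M) : c.app t = 0 := by
  induction hY generalizing F with
  | base v =>
    let c' : (tau v).obj F ⟶ (Functor.const M).obj W :=
      { app := fun t => F.map (β_ v t).hom ≫ c.app t
        naturality := fun t t' h => by
          refine Eq.trans ?_ (Category.comp_id _).symm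
          change F.map (v ◁ h) ≫ F.map (β_ v t').hom ≫ c.app t' = _
          rw [← F.map_comp_assoc, BraidedCategory.braiding_naturality_right, F.map_comp_assoc,
            c.w] }
    rw [← cancel_epi (F.map (β_ v t).hom), comp_zero]
    exact NatTrans.congr_app (hom_const_eq_zero (stablyNull_tau v hF) c') t
  | cons n y Y S h ih =>
    obtain ⟨d, hd⟩ := exists_delta_desc c fun t => hc _ .head t
    rw [← cancel_epi (F.map (tensorSwap y t Y).hom), ← hd,
      ih (hF y) d (kills_of_desc c hc d hd), comp_zero, comp_zero]

lemma SumCocone.app_eq {n : ℕ} {F : M ⥤ B} (hF : PolF n F) {Y : M}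
    {S : ∀ ⦃Y' : M⦄, (Y' ⟶ Y) → Prop} (hY : IsSum n Y S) {W : B}
    (c c' : SumCocone F Y W) (h : ∀ ⦃Y' : M⦄ (a : Y' ⟶ Y), S a → ∀ t : M,
      F.map (t ◁ a) ≫ c.app t = F.map (t ◁ a) ≫ c'.app t) (t : M) : c.app t = c'.app t := by
  rw [← sub_eq_zero]
  refine (c - c').app_eq_zero hF hY (fun Y' a ha t => ?_) t
  rw [SumCocone.sub_app, Preadditive.comp_sub, h a ha, sub_self]

end Vanishing

/-! ### Coproducts and cokernels modulo stably null functors -/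

section Coproducts

variable {M : Type w} [SmallCategory M] [MonoidalCategory M] [UnitInitial M]
  {B : Type u} [Category.{w} B] [Abelian B] [IsGrothendieckAbelian.{w} B]

lemma stablyNull_colimit {J : Type w} [SmallCategory J] (G : J ⥤ M ⥤ B)
    (hG : ∀ j, stablyNull M B (G.obj j)) : stablyNull M B (colimit G) := by
  refine (stablyNull_iff' _).2 fun Z f hf => colimit.hom_ext fun j => ?_
  rw [comp_zero]
  refine (stablyNull_iff' _).1 (hG j) _ fun x W p hp => ?_
  rw [← Category.assoc]
  apply hf x
  rw [Category.assoc, iota_naturality, reassoc_of% hp, zero_comp]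

/-- Coproducts are exact here, so kernel and cokernel are computed termwise, and stably null
functors are stable under colimits. -/
lemma isoModSerre_colimMap_discrete {J : Type w} {X Y : Discrete J ⥤ M ⥤ B} (α : X ⟶ Y)
    (hα : ∀ j, (stablyNull M B).isoModSerre (α.app j)) :
    (stablyNull M B).isoModSerre (colim.map α) := by
  constructor
  · refine (stablyNull M B).prop_of_iso (PreservesKernel.iso colim α)
      (stablyNull_colimit (kernel α) fun j => ?_)
    exact (stablyNull M B).prop_of_iso
      (PreservesKernel.iso ((evaluation (Discrete J) (M ⥤ B)).obj j) α).symm (hα j).1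
  · refine (stablyNull M B).prop_of_iso (PreservesCokernel.iso colim α)
      (stablyNull_colimit (cokernel α) fun j => ?_)
    exact (stablyNull M B).prop_of_iso
      (PreservesCokernel.iso ((evaluation (Discrete J) (M ⥤ B)).obj j) α).symm (hα j).2

lemma isoModSerre_cokernel_map {X Y X' Y' : M ⥤ B} (f : X ⟶ Y) (f' : X' ⟶ Y') (p : X ⟶ X')
    (q : Y ⟶ Y') (h : f ≫ q = p ≫ f') (hp : (stablyNull M B).isoModSerre p)
    (hq : (stablyNull M B).isoModSerre q) :
    (stablyNull M B).isoModSerre (cokernel.map f f' p q h) := by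
  rw [← ObjectProperty.SerreClassLocalization.isIso_map_iff (proj M B)]
  have h1 : IsIso ((proj M B).map p) := Localization.inverts _ (stablyNull M B).isoModSerre _ hp
  have h2 : IsIso ((proj M B).map q) := Localization.inverts _ (stablyNull M B).isoModSerre _ hq
  have := ObjectProperty.SerreClassLocalization.preservesCokernel (proj M B) (stablyNull M B) f
  have := ObjectProperty.SerreClassLocalization.preservesCokernel (proj M B) (stablyNull M B) f'
  have := ObjectProperty.SerreClassLocalization.hasCokernels (proj M B) (stablyNull M B)
  have hM : IsIso (cokernel.map ((proj M B).map f) ((proj M B).map f') ((proj M B).map p)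
      ((proj M B).map q) (by rw [← Functor.map_comp, ← Functor.map_comp, h])) :=
    (cokernel.mapIso ((proj M B).map f) ((proj M B).map f') (asIso ((proj M B).map p))
      (asIso ((proj M B).map q)) (by simp only [asIso_hom, ← Functor.map_comp, h])).isIso_hom
  have h3 := preserves_cokernel_iso_comp_cokernel_map (G := proj M B) (f := f) (g := f')
    (p := p) (q := q) (hpq := h)
  rw [(Iso.eq_comp_inv _).2 h3.symm]
  exact IsIso.comp_isIso' (IsIso.comp_isIso' (Iso.isIso_hom _) hM) (Iso.isIso_inv _)

end Coproducts

/-! ### Bounding the degree of a subfunctor by natural families -/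

section Detection

variable {M : Type w} [SmallCategory M] [MonoidalCategory M] [SymmetricCategory M] [UnitInitial M]
  {B : Type u} [Category.{w} B] [Abelian B] [IsGrothendieckAbelian.{w} B]

/-- The universal family with `v` fixed has target the colimit over `t` of `F(t ⊕ v)`. Each `i_t` is
invertible modulo stably null functors, so `F` embeds into this colimit up to a stably null kernel,
and the hypothesis says that `K` lies in that kernel. -/
lemma stablyNull_of_sumCocone {F K : M ⥤ B} (hF : PolF 1 F) (j : K ⟶ F) [Mono j]
    (hj : ∀ (v : M) (W : B) (c : SumCocone F v W) (t : M), j.app (t ⊗ v) ≫ c.app t = 0) :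
    stablyNull M B K := by
  let P := stablyNull M B
  -- Since `M` need not be filtered, both colimits over `M`, of the constant diagram `F` and of `t ↦
  -- τ_t F`, are presented as cokernels between coproducts, for which the comparison is known.
  let X₀ : Discrete M ⥤ M ⥤ B := Discrete.functor fun _ => F
  let Y₀ : Discrete M ⥤ M ⥤ B := Discrete.functor fun t => (tau t).obj F
  let α₀ : X₀ ⟶ Y₀ := Discrete.natTrans fun t => iota t.as F
  let J := Σ s t : M, (s ⟶ t)
  let X₁ : Discrete J ⥤ M ⥤ B := Discrete.functor fun _ => F
  let Y₁ : Discrete J ⥤ M ⥤ B := Discrete.functor fun f => (tau f.1).obj F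
  let α₁ : X₁ ⟶ Y₁ := Discrete.natTrans fun f => iota f.as.1 F
  have hiota (t : M) : P.isoModSerre (iota t F) := ⟨stablyNull_kernel_iota t F, hF t⟩
  have h₀ : P.isoModSerre (colim.map α₀) := isoModSerre_colimMap_discrete α₀ fun t => hiota t.as
  have h₁ : P.isoModSerre (colim.map α₁) := isoModSerre_colimMap_discrete α₁ fun f => hiota f.as.1
  let i₀ (t : M) : F ⟶ colimit X₀ := colimit.ι X₀ ⟨t⟩
  let k₀ (t : M) : (tau t).obj F ⟶ colimit Y₀ := colimit.ι Y₀ ⟨t⟩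
  let i₁ (f : J) : F ⟶ colimit X₁ := colimit.ι X₁ ⟨f⟩
  let k₁ (f : J) : (tau f.1).obj F ⟶ colimit Y₁ := colimit.ι Y₁ ⟨f⟩
  have hα₀ (t : M) : i₀ t ≫ colim.map α₀ = iota t F ≫ k₀ t := colimit.ι_map α₀ ⟨t⟩
  have hα₁ (f : J) : i₁ f ≫ colim.map α₁ = iota f.1 F ≫ k₁ f := colimit.ι_map α₁ ⟨f⟩
  let m (f : J) : (tau f.1).obj F ⟶ (tau f.2.1).obj F :=
    Functor.whiskerRight ((tensoringLeft M).map f.2.2) F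
  let dX : colimit X₁ ⟶ colimit X₀ := colimit.desc X₁ (Cofan.mk _ fun f : J => i₀ f.1 - i₀ f.2.1)
  let dY : colimit Y₁ ⟶ colimit Y₀ := colimit.desc Y₁ (Cofan.mk _ fun f : J =>
    k₀ f.1 - m f ≫ k₀ f.2.1)
  have hdX (f : J) : i₁ f ≫ dX = i₀ f.1 - i₀ f.2.1 := colimit.ι_desc _ _
  have hdY (f : J) : k₁ f ≫ dY =
    k₀ f.1 - m f ≫ k₀ f.2.1 := colimit.ι_desc _ _
  have hsq : dX ≫ colim.map α₀ = colim.map α₁ ≫ dY := by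
    refine colimit.hom_ext fun ⟨f⟩ => ?_
    change i₁ f ≫ dX ≫ colim.map α₀ = i₁ f ≫ colim.map α₁ ≫ dY
    rw [reassoc_of% hdX f, reassoc_of% hα₁ f, hdY, Preadditive.sub_comp, hα₀, hα₀,
      Preadditive.comp_sub, ← Category.assoc (iota f.1 F),
      show iota f.1 F ≫ m f = _ from iota_comp_map f.2.2 F]
  let r : cokernel dX ⟶ F := cokernel.desc dX (colimit.desc X₀ (Cofan.mk _ fun _ => 𝟙 F)) (by
    refine colimit.hom_ext fun ⟨f⟩ => ?_
    have h (t : M) : i₀ t ≫ colimit.desc X₀ (Cofan.mk _ fun _ => 𝟙 F) = 𝟙 F := colimit.ι_desc _ _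
    change i₁ f ≫ dX ≫ _ = i₁ f ≫ 0
    rw [reassoc_of% hdX f, Preadditive.sub_comp, h, h, sub_self, comp_zero])
  -- The codiagonal retracts `F` off the colimit of the constant diagram.
  let s : F ⟶ cokernel dX := i₀ (𝟙_ M) ≫ cokernel.π dX
  have hs : s ≫ r = 𝟙 F := by
    rw [Category.assoc, cokernel.π_desc]
    exact colimit.ι_desc _ _
  have : Mono s := by
    have : Mono (s ≫ r) := by rw [hs]; infer_instance
    exact mono_of_mono s r
  let g := s ≫ cokernel.map dX dY (colim.map α₁) (colim.map α₀) hsq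
  have hg : P.monoModSerre g := P.monoModSerre.comp_mem _ _ (P.monoModSerre_of_mono s)
    (isoModSerre_cokernel_map dX dY _ _ hsq h₁ h₀).1
  have hjg : j ≫ g = 0 := by
    have e : g = iota (𝟙_ M) F ≫ k₀ (𝟙_ M) ≫ cokernel.π dY := by
      simp only [g, s, Category.assoc, cokernel.π_desc]
      rw [reassoc_of% hα₀ (𝟙_ M)]
    ext v
    let c : SumCocone F v ((cokernel dY).obj v) :=
      { app := fun t => (k₀ t ≫ cokernel.π dY).app v
        w := fun {t t'} h => by
          have h' : k₁ ⟨t, t', h⟩ ≫ dY ≫ cokernel.π dY = 0 := by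
            rw [cokernel.condition, comp_zero]
          rw [reassoc_of% hdY ⟨t, t', h⟩, Preadditive.sub_comp, sub_eq_zero] at h'
          rw [Category.assoc] at h'
          exact (NatTrans.congr_app h' v).symm }
    rw [e]
    have h := hj v _ c (𝟙_ M)
    change j.app v ≫ F.map (unitTo (𝟙_ M) v) ≫ c.app (𝟙_ M) = 0
    rw [← j.naturality_assoc, h, comp_zero]
  have : Mono (kernel.lift g j hjg) := by
    have : Mono (kernel.lift g j hjg ≫ kernel.ι g) := by rw [kernel.lift_ι]; infer_instance
    exact mono_of_mono _ (kernel.ι g)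
  exact P.prop_of_mono (kernel.lift g j hjg) hg

/-- A subfunctor `K` of a functor `F` is polynomial of degree less than `n` when `F` is of
degree at most `n` and the natural families of morphisms `F(t ⊕ y₁ ⊕ ⋯ ⊕ yₙ ⊕ v) ⟶ W` which
vanish when a `yᵢ` is omitted vanish on `K`. -/
lemma polF_of_sumCocone (n : ℕ) {F K : M ⥤ B} (hF : PolF (n + 1) F) (j : K ⟶ F) [Mono j]
    (hj : ∀ ⦃Y : M⦄ ⦃S : ∀ ⦃Y' : M⦄, (Y' ⟶ Y) → Prop⦄, IsSum n Y S →
      ∀ (W : B) (c : SumCocone F Y W), c.Kills S → ∀ t : M, j.app (t ⊗ Y) ≫ c.app t = 0) :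
    PolF n K := by
  induction n generalizing F K with
  | zero =>
    exact stablyNull_of_sumCocone hF j fun v W c t => hj (.base v) W c (fun _ _ h => h.elim) t
  | succ n ih =>
    rw [polF_succ_iff]
    intro y
    let f := (delta y).map j
    have h₁ : PolF n (Abelian.image f) := by
      -- The functor `δ_y K` need not embed in `δ_y F`, so the induction hypothesis is applied to
      -- its image; the error is stably null. A family on `δ_y F` pulls back to one on `F` and `y ⊕
      -- Y` which also vanishes when `y` is omitted.
      refine ih (hF y) (Abelian.image.ι f) fun Y S hY W d hd t => ?_
      let c : SumCocone F (y ⊗ Y) W :=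
        { app := fun t => F.map (tensorSwap y t Y).inv ≫ ((deltaπ y).app F).app (t ⊗ Y) ≫ d.app t
          w := fun {t t'} h => by
            have h' : F.map (y ◁ (h ▷ Y)) ≫ ((deltaπ y).app F).app (t' ⊗ Y) =
              ((deltaπ y).app F).app (t ⊗ Y) ≫ ((delta y).obj F).map (h ▷ Y) :=
              ((deltaπ y).app F).naturality (h ▷ Y)
            rw [← cancel_epi (F.map (tensorSwap y t Y).hom), ← F.map_comp_assoc,
              ← tensorSwap_naturality_middle, F.map_comp_assoc, Iso.map_hom_inv_id_assoc,
              Iso.map_hom_inv_id_assoc, reassoc_of% h', d.w] }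
      have hc : c.Kills (ConsOmits y S) := by
        rintro _ _ (_ | ⟨a, ha⟩) t
        · have h' : F.map (unitTo y (t ⊗ Y)) ≫ ((deltaπ y).app F).app (t ⊗ Y) = 0 :=
            NatTrans.congr_app (iota_deltaπ y F) (t ⊗ Y)
          rw [← unitTo_tensorSwap, F.map_comp_assoc, Iso.map_hom_inv_id_assoc, reassoc_of% h',
            zero_comp]
        · rename_i Y'
          have h' : F.map (y ◁ (t ◁ a)) ≫ ((deltaπ y).app F).app (t ⊗ Y) =
            ((deltaπ y).app F).app (t ⊗ Y') ≫ ((delta y).obj F).map (t ◁ a) :=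
            ((deltaπ y).app F).naturality (t ◁ a)
          rw [← cancel_epi (F.map (tensorSwap y t Y').hom), ← F.map_comp_assoc,
            ← tensorSwap_naturality_right, F.map_comp_assoc, Iso.map_hom_inv_id_assoc,
            reassoc_of% h', hd a ha, comp_zero, comp_zero]
      have h₁ : j.app (y ⊗ (t ⊗ Y)) ≫ ((deltaπ y).app F).app (t ⊗ Y) =
          ((deltaπ y).app K).app (t ⊗ Y) ≫ f.app (t ⊗ Y) :=
        NatTrans.congr_app ((deltaπ y).naturality j) (t ⊗ Y)
      have h₂ : f.app (t ⊗ Y) =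
          (Abelian.factorThruImage f).app (t ⊗ Y) ≫ (Abelian.image.ι f).app (t ⊗ Y) :=
        NatTrans.congr_app (Abelian.image.fac f).symm (t ⊗ Y)
      rw [← cancel_epi ((Abelian.factorThruImage f).app (t ⊗ Y)),
        ← cancel_epi (((deltaπ y).app K).app (t ⊗ Y)), comp_zero, comp_zero,
        ← reassoc_of% h₂, ← reassoc_of% h₁]
      have h₃ := hj (.cons n y Y S hY) W c hc t
      rw [← cancel_epi (K.map (tensorSwap y t Y).hom), comp_zero, j.naturality_assoc,
        Iso.map_hom_inv_id_assoc] at h₃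
      exact h₃
    refine prop_of_prop_kernel (PolF n) (Abelian.factorThruImage f) ?_ h₁
    have h₂ := stablyNull_kernel_delta_map y j
    refine stablyNull_le_polF n _ ((stablyNull M B).prop_of_iso ?_ h₂)
    exact kernelIsoOfEq (Abelian.image.fac f).symm ≪≫
      kernelCompMono (Abelian.factorThruImage f) (Abelian.image.ι f)

end Detection

/-! ### Functors on `A` and their restriction to hermitian objects -/

section Functoriality

variable {M : Type w} [SmallCategory M] [MonoidalCategory M] [UnitInitial M]
  {B : Type u} [Category.{w} B] [Abelian B]

/-- The functoriality of `δ_x(F)` in `x`. -/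
noncomputable def deltaMap {x y : M} (f : x ⟶ y) (F : M ⥤ B) :
    (delta x).obj F ⟶ (delta y).obj F :=
  cokernel.map (iota x F) (iota y F) (𝟙 F) (Functor.whiskerRight ((tensoringLeft M).map f) F)
    (by rw [iota_comp_map, Category.id_comp])

lemma deltaπ_deltaMap {x y : M} (f : x ⟶ y) (F : M ⥤ B) :
    (deltaπ x).app F ≫ deltaMap f F =
      Functor.whiskerRight ((tensoringLeft M).map f) F ≫ (deltaπ y).app F :=
  cokernel.π_desc _ _ _

lemma deltaMap_comp_eq_id {x y : M} (i : x ⟶ y) (r : y ⟶ x) (h : i ≫ r = 𝟙 x) (F : M ⥤ B) :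
    deltaMap i F ≫ deltaMap r F = 𝟙 _ := by
  have h' : Functor.whiskerRight ((tensoringLeft M).map i) F ≫
      Functor.whiskerRight ((tensoringLeft M).map r) F = 𝟙 _ := by
    ext z
    simp [← Functor.map_comp, ← comp_whiskerRight, h]
  rw [← cancel_epi ((deltaπ x).app F), reassoc_of% (deltaπ_deltaMap i F), deltaπ_deltaMap, reassoc_of% h']
  exact (Category.comp_id _).symm

end Functoriality

section Additive

variable {A : Type w} [SmallCategory A] [Preadditive A] [CartesianMonoidalCategory A]
  [BraidedCategory A] {B : Type u} [Category.{w} B] [Abelian B] 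

open CartesianMonoidalCategory

@[simp]
lemma unitTo_fst (x z : A) : unitTo x z ≫ fst x z = 0 := by
  have h : UnitInitial.isInitial.to x = (0 : 𝟙_ A ⟶ x) := UnitInitial.isInitial.hom_ext _ _
  simp [unitTo, h]

@[simp]
lemma unitTo_snd (x z : A) : unitTo x z ≫ snd x z = 𝟙 z := by
  simp [unitTo]

@[simp]
lemma unitTo_fst_assoc (x z : A) {w : A} (f : x ⟶ w) : unitTo x z ≫ fst x z ≫ f = 0 := by
  rw [← Category.assoc, unitTo_fst, zero_comp]

@[simp]
lemma unitTo_snd_assoc (x z : A) {w : A} (f : z ⟶ w) : unitTo x z ≫ snd x z ≫ f = f := by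
  rw [← Category.assoc, unitTo_snd, Category.id_comp]

variable {M : Type w} [SmallCategory M] [MonoidalCategory M] [UnitInitial M]

variable [IsGrothendieckAbelian.{w} B]

/-- The second projection splits `z ⟶ x ⊕ z` in `A`, so all `i_x` are monomorphisms. -/
lemma isZero_of_stablyNull {F : A ⥤ B} (hF : stablyNull A B F) : IsZero F := by
  rw [IsZero.iff_id_eq_zero]
  refine (stablyNull_iff F).1 hF _ fun x => ?_
  have : Mono (iota x F) := by
    have (z : A) : Mono ((iota x F).app z) := by
      have : Mono ((iota x F).app z ≫ F.map (snd x z)) := by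
        rw [iota_app, ← F.map_comp, unitTo_snd, F.map_id]
        infer_instance
      exact mono_of_mono _ (F.map (snd x z))
    exact NatTrans.mono_of_mono_app _
  rw [kernel.ι_of_mono, zero_comp]

end Additive

section Restriction

variable {A : Type w} [SmallCategory A] [Preadditive A] [CartesianMonoidalCategory A]
  [BraidedCategory A] {𝔇 : Duality A} {ε : ℤˣ} {k : FormKind}

namespace Herm

open CartesianMonoidalCategory

/-- The object of `A` underlying an object of `H^T(A)`. -/
abbrev carrier (x : Herm 𝔇 ε k) : A := x.obj.obj

/-- The value of the form of `x` on `f`. -/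
noncomputable def q (x : Herm 𝔇 ε k) {P : A} (f : P ⟶ carrier x) : (𝔇.forms ε k).obj (.op P) :=
  res (𝔇.forms ε k) f x.obj.form

lemma res_q (x : Herm 𝔇 ε k) {P Q : A} (g : Q ⟶ P) (f : P ⟶ carrier x) :
    res (𝔇.forms ε k) g (x.q f) = x.q (g ≫ f) := res_res _ _ _ _

/-- A morphism of `A` which is compatible with forms. -/
noncomputable def mkHom {x y : Herm 𝔇 ε k} (f : carrier x ⟶ carrier y) (w : y.q f = x.q (𝟙 _)) : x ⟶ y :=
  ObjectProperty.homMk { hom := f, w := w.trans (res_id _ _) }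

/-- The underlying morphism of `A`. -/
abbrev hom {x y : Herm 𝔇 ε k} (f : x ⟶ y) : carrier x ⟶ carrier y := f.hom.hom

@[simp]
lemma hom_mkHom {x y : Herm 𝔇 ε k} (f : carrier x ⟶ carrier y) (w) : hom (mkHom f w) = f := rfl

lemma hom_ext {x y : Herm 𝔇 ε k} {f g : x ⟶ y} (h : hom f = hom g) : f = g := by
  ext
  exact h

lemma q_hom {x y : Herm 𝔇 ε k} (f : x ⟶ y) {P : A} (g : P ⟶ carrier x) :
    y.q (g ≫ hom f) = x.q g := by
  rw [← res_q]
  congr 1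
  exact f.hom.w

@[simp]
lemma hom_comp {x y z : Herm 𝔇 ε k} (f : x ⟶ y) (g : y ⟶ z) : hom (f ≫ g) = hom f ≫ hom g := rfl

lemma q_tensor (x y : Herm 𝔇 ε k) {P : A} (f : P ⟶ carrier x ⊗ carrier y) :
    (x ⊗ y).q f = x.q (f ≫ fst _ _) + y.q (f ≫ snd _ _) :=
  Formed.res_sum _ _ _

@[simp]
lemma hom_whiskerLeft (x : Herm 𝔇 ε k) {y z : Herm 𝔇 ε k} (f : y ⟶ z) :
    hom (x ◁ f) = carrier x ◁ hom f := rfl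

@[simp]
lemma hom_whiskerRight {y z : Herm 𝔇 ε k} (f : y ⟶ z) (x : Herm 𝔇 ε k) :
    hom (f ▷ x) = hom f ▷ carrier x := rfl

lemma hom_unitTo (x z : Herm 𝔇 ε k) : hom (unitTo x z) = unitTo (carrier x) (carrier z) := by
  change (λ_ (carrier z)).inv ≫ _ ▷ carrier z = _
  rfl

end Herm

variable {B : Type u} [Category.{w} B] [Abelian B] 

/-- The difference functors commute with the restriction along `π^T`. -/
noncomputable def deltaForgetIso (x : Herm 𝔇 ε k) (F : A ⥤ B) :
    (delta x).obj (Herm.forget 𝔇 ε k ⋙ F) ≅ Herm.forget 𝔇 ε k ⋙ (delta x.carrier).obj F :=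
  cokernel.mapIso _ (((Functor.whiskeringLeft _ _ B).obj (Herm.forget 𝔇 ε k)).map
      (iota x.carrier F)) (Iso.refl _) (NatIso.ofComponents (fun z => Iso.refl _)
      (fun {y z} f => (Category.comp_id _).trans (Category.id_comp _).symm)) (by
        ext z
        change F.map (Herm.hom (unitTo x z)) ≫ 𝟙 _ = 𝟙 _ ≫ F.map (unitTo x.carrier z.carrier)
        rw [Category.comp_id, Category.id_comp, Herm.hom_unitTo]) ≪≫
    (PreservesCokernel.iso ((Functor.whiskeringLeft _ _ B).obj (Herm.forget 𝔇 ε k))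
      (iota x.carrier F)).symm

variable [IsGrothendieckAbelian.{w} B]

lemma polF_forget_comp (n : ℕ) {F : A ⥤ B} (hF : PolF n F) :
    PolF n (Herm.forget 𝔇 ε k ⋙ F) := by
  induction n generalizing F with
  | zero =>
    have h := isZero_of_stablyNull hF
    have : IsZero (Herm.forget 𝔇 ε k ⋙ F) := by
      rw [IsZero.iff_id_eq_zero]
      ext z
      exact NatTrans.congr_app (h.eq_of_src (𝟙 F) 0) _
    exact (stablyNull _ B).prop_of_isZero this
  | succ n ih =>
    rw [polF_succ_iff]
    exact fun x => (PolF n).prop_of_iso (deltaForgetIso x F).symm (ih (hF x.carrier))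

/-- If `V` is a retract of the object underlying `x`, then `δ_V` is a retract of `δ_x`, which can be
tested on hermitian objects. `exists_retract` supplies the hypothesis with hyperbolic objects. -/
lemma polF_of_polF_forget_comp (hA : ∀ V : A, ∃ (x : Herm 𝔇 ε k) (i : V ⟶ x.carrier)
      (r : x.carrier ⟶ V), i ≫ r = 𝟙 V) (n : ℕ) {F : A ⥤ B}
    (hF : PolF n (Herm.forget 𝔇 ε k ⋙ F)) : PolF n F := by
  induction n generalizing F with
  | zero =>
    have h₁ : Herm.forget 𝔇 ε k ⋙ F |> IsZero := by
      rw [IsZero.iff_id_eq_zero]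
      refine (stablyNull_iff _).1 hF _ fun x => ?_
      have : Mono (iota x (Herm.forget 𝔇 ε k ⋙ F)) := by
        have (z : Herm 𝔇 ε k) : Mono ((iota x (Herm.forget 𝔇 ε k ⋙ F)).app z) := by
          let r : F.obj (x.carrier ⊗ z.carrier) ⟶ F.obj z.carrier :=
            F.map (CartesianMonoidalCategory.snd x.carrier z.carrier)
          have : Mono ((iota x (Herm.forget 𝔇 ε k ⋙ F)).app z ≫ r) := by
            have h : (iota x (Herm.forget 𝔇 ε k ⋙ F)).app z ≫ r = 𝟙 _ := by
              change F.map (Herm.hom (unitTo x z)) ≫ F.map _ = 𝟙 _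
              rw [← F.map_comp, Herm.hom_unitTo, unitTo_snd, F.map_id]
            rw [h]
            exact inferInstanceAs (Mono (𝟙 (F.obj z.carrier)))
          exact mono_of_mono _ r
        exact NatTrans.mono_of_mono_app _
      rw [kernel.ι_of_mono, zero_comp]
    have h₂ : IsZero F := by
      rw [IsZero.iff_id_eq_zero]
      ext V
      obtain ⟨x, i, r, hir⟩ := hA V
      have h : 𝟙 (F.obj x.carrier) = 0 := NatTrans.congr_app (h₁.eq_of_src (𝟙 _) 0) x
      change 𝟙 (F.obj V) = 0
      rw [← F.map_id, ← hir, F.map_comp, ← Category.id_comp (F.map r), h, zero_comp, comp_zero]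
    exact (stablyNull _ B).prop_of_isZero h₂
  | succ n ih =>
    rw [polF_succ_iff]
    intro V
    obtain ⟨x, i, r, hir⟩ := hA V
    have h := deltaMap_comp_eq_id i r hir F
    have : Mono (deltaMap i F) := by
      have : Mono (deltaMap i F ≫ deltaMap r F) := by rw [h]; exact inferInstanceAs (Mono (𝟙 _))
      exact mono_of_mono _ (deltaMap r F)
    exact (PolF n).prop_of_mono (deltaMap i F)
      (ih ((PolF n).prop_of_iso (deltaForgetIso x F) (hF x)))

end Restriction

/-! ### Calculus of forms: polarization, opposite forms, hyperbolic objects -/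

section FormsCalculus

open CartesianMonoidalCategory

variable {A : Type w} [SmallCategory A] [Preadditive A] (𝔇 : Duality A) (ε : ℤˣ) (k : FormKind)

/-- The projection `TD² ⟶ T`. -/
noncomputable def Duality.toForms : (k : FormKind) → (𝔇.TD2 ⟶ 𝔇.forms ε k)
  | .sym => cokernel.π (𝔇.antinorm ε)
  | .symBar => factorThruImage (𝔇.norm ε)

instance : Epi (𝔇.toForms ε k) := by
  cases k
  · exact inferInstanceAs (Epi (cokernel.π (𝔇.antinorm ε)))
  · exact inferInstanceAs (Epi (factorThruImage (𝔇.norm ε)))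

lemma Duality.toForms_toTD2 : 𝔇.toForms ε k ≫ 𝔇.toTD2 ε k = 𝔇.norm ε := by
  cases k
  · exact cokernel.π_desc _ _ _
  · exact image.fac _

variable {𝔇 ε k}

/-- The form defined by a morphism `u : X ⟶ D X`. -/
noncomputable def Duality.mkForm {X : A} (u : X ⟶ 𝔇.D.obj (.op X)) :
    (𝔇.forms ε k).obj (.op X) :=
  (𝔇.toForms ε k).app (.op X) u

lemma Duality.mkForm_add {X : A} (u v : X ⟶ 𝔇.D.obj (.op X)) :
    (Duality.mkForm (u + v) : (𝔇.forms ε k).obj (.op X)) = Duality.mkForm u + Duality.mkForm v :=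
  _root_.map_add ((𝔇.toForms ε k).app (.op X)).hom u v

lemma Duality.mkForm_surjective {X : A} (c : (𝔇.forms ε k).obj (.op X)) :
    ∃ u : X ⟶ 𝔇.D.obj (.op X), Duality.mkForm u = c :=
  (AddCommGrpCat.epi_iff_surjective ((𝔇.toForms ε k).app (.op X))).1 inferInstance c

lemma Duality.res_mkForm {X Y : A} (f : X ⟶ Y) (u : Y ⟶ 𝔇.D.obj (.op Y)) :
    res (𝔇.forms ε k) f (Duality.mkForm u) = Duality.mkForm (f ≫ u ≫ 𝔇.D.map f.op) :=
  (ConcreteCategory.congr_hom ((𝔇.toForms ε k).naturality f.op) u).symm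

lemma Duality.toTD2_mkForm {X : A} (u : X ⟶ 𝔇.D.obj (.op X)) :
    ((𝔇.toTD2 ε k).app (.op X) (Duality.mkForm u) : X ⟶ 𝔇.D.obj (.op X)) =
      u + (ε : ℤ) • 𝔇.σ X X u :=
  ConcreteCategory.congr_hom (NatTrans.congr_app (𝔇.toForms_toTD2 ε k) (.op X)) u

lemma Duality.map_zero' (P Q : A) : 𝔇.D.map (0 : P ⟶ Q).op = 0 := by
  have := 𝔇.map_add (0 : P ⟶ Q) 0
  rwa [add_zero, left_eq_add] at this

lemma Duality.map_neg {P Q : A} (f : P ⟶ Q) : 𝔇.D.map (-f).op = - 𝔇.D.map f.op := by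
  rw [eq_neg_iff_add_eq_zero, ← 𝔇.map_add, neg_add_cancel, 𝔇.map_zero']

variable [CartesianMonoidalCategory A] [BraidedCategory A]

namespace Herm

lemma exists_q_eq (x : Herm 𝔇 ε k) : ∃ u : x.carrier ⟶ 𝔇.D.obj (.op x.carrier),
    ∀ {P : A} (f : P ⟶ x.carrier), x.q f = Duality.mkForm (f ≫ u ≫ 𝔇.D.map f.op) := by
  obtain ⟨u, hu⟩ := Duality.mkForm_surjective x.obj.form
  exact ⟨u, fun f => by rw [q, ← hu, Duality.res_mkForm]⟩

/-- The symmetric bilinear form associated with the quadratic form of `x`. -/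
noncomputable def polar (x : Herm 𝔇 ε k) {P : A} (f g : P ⟶ x.carrier) :
    (𝔇.forms ε k).obj (.op P) :=
  x.q (f + g) - x.q f - x.q g

variable (x : Herm 𝔇 ε k) {P : A}

lemma exists_polar_eq : ∃ u : x.carrier ⟶ 𝔇.D.obj (.op x.carrier),
    ∀ {P : A} (f g : P ⟶ x.carrier), x.polar f g =
      Duality.mkForm (f ≫ u ≫ 𝔇.D.map g.op) + Duality.mkForm (g ≫ u ≫ 𝔇.D.map f.op) := by
  obtain ⟨u, hu⟩ := x.exists_q_eq
  refine ⟨u, fun f g => ?_⟩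
  rw [polar, hu, hu, hu, 𝔇.map_add]
  simp only [Preadditive.add_comp, Preadditive.comp_add, Duality.mkForm_add]
  abel

lemma polar_comm (f g : P ⟶ x.carrier) : x.polar f g = x.polar g f := by
  rw [polar, polar, add_comm f g]
  abel

lemma polar_add_left (f f' g : P ⟶ x.carrier) :
    x.polar (f + f') g = x.polar f g + x.polar f' g := by
  obtain ⟨u, hu⟩ := x.exists_polar_eq
  rw [hu, hu, hu, 𝔇.map_add]
  simp only [Preadditive.add_comp, Preadditive.comp_add, Duality.mkForm_add]
  abel

lemma polar_zero_left (g : P ⟶ x.carrier) : x.polar 0 g = 0 := by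
  simpa using x.polar_add_left 0 0 g

lemma polar_neg_left (f g : P ⟶ x.carrier) : x.polar (-f) g = - x.polar f g := by
  rw [eq_neg_iff_add_eq_zero, ← polar_add_left, neg_add_cancel, polar_zero_left]

lemma polar_neg_right (f g : P ⟶ x.carrier) : x.polar f (-g) = - x.polar f g := by
  rw [polar_comm, polar_neg_left, polar_comm]

@[simp]
lemma q_neg (f : P ⟶ x.carrier) : x.q (-f) = x.q f := by
  obtain ⟨u, hu⟩ := x.exists_q_eq
  rw [hu, hu, Duality.map_neg]
  simp

@[simp]
lemma q_zero : x.q (0 : P ⟶ x.carrier) = 0 := by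
  have := x.polar_zero_left (0 : P ⟶ x.carrier)
  rw [polar, add_zero] at this
  simpa using this

lemma q_add (f g : P ⟶ x.carrier) : x.q (f + g) = x.q f + x.q g + x.polar f g := by
  rw [polar]
  abel

lemma polar_self (f : P ⟶ x.carrier) : x.polar f f = x.q f + x.q f := by
  have := x.q_add f (-f)
  rw [add_neg_cancel, q_zero, q_neg, polar_neg_right] at this
  rw [← sub_eq_zero, ← neg_eq_zero, this]
  abel

/-- The form of `x`, seen as a morphism to the dual. -/
noncomputable def toDual : x.carrier ⟶ 𝔇.D.obj (.op x.carrier) :=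
  (𝔇.toTD2 ε k).app (.op x.carrier) x.obj.form

instance : IsIso x.toDual := x.property

/-- The form of `x` is the restriction of that of `y` along `f`; as it is invertible, the adjoint of
`f` provides a retraction, in `A` only. -/
lemma exists_retraction {x y : Herm 𝔇 ε k} (f : x ⟶ y) :
    ∃ r : y.carrier ⟶ x.carrier, hom f ≫ r = 𝟙 _ := by
  have h : x.toDual = hom f ≫ y.toDual ≫ 𝔇.D.map (hom f).op := by
    rw [toDual, ← show res _ (hom f) y.obj.form = x.obj.form from f.hom.w]
    exact toTD2_res 𝔇 ε k (hom f) _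
  exact ⟨y.toDual ≫ 𝔇.D.map (hom f).op ≫ inv x.toDual, by
    rw [← Category.assoc y.toDual, ← Category.assoc, ← h, IsIso.hom_inv_id]⟩

/-- The opposite form. -/
noncomputable def opposite : Herm 𝔇 ε k where
  obj := ⟨x.carrier, - x.obj.form⟩
  property := by
    have h : ((𝔇.toTD2 ε k).app (.op x.carrier) (-x.obj.form) :
        x.carrier ⟶ 𝔇.D.obj (.op x.carrier)) = - x.toDual :=
      _root_.map_neg ((𝔇.toTD2 ε k).app (.op x.carrier)).hom _
    change IsIso ((𝔇.toTD2 ε k).app (.op x.carrier) (-x.obj.form) :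
        x.carrier ⟶ 𝔇.D.obj (.op x.carrier))
    rw [h]
    exact ⟨-inv x.toDual, by simp, by simp⟩

lemma q_opposite (f : P ⟶ x.carrier) : x.opposite.q f = - x.q f :=
  _root_.map_neg (res (𝔇.forms ε k) f) _

/-- The hyperbolic object on `V`. -/
noncomputable def hyperbolic (V : A) : Herm 𝔇 ε k where
  obj := ⟨V ⊗ 𝔇.D.obj (.op V), Duality.mkForm (snd _ _ ≫ 𝔇.D.map (fst _ _).op)⟩
  property := by
    let W : A := 𝔇.D.obj (.op V)
    let η : V ⟶ 𝔇.D.obj (.op W) := 𝔇.σ W V (𝟙 W)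
    have hη : IsIso η := 𝔇.isIso_unit V
    have hu : 𝔇.σ _ _ (snd V W ≫ 𝔇.D.map (fst V W).op) =
        fst V W ≫ η ≫ 𝔇.D.map (snd V W).op := by
      rw [𝔇.σ_naturality_left, ← Category.id_comp (𝔇.D.map (fst V W).op), 𝔇.σ_naturality_right,
        Category.assoc]
    change IsIso ((𝔇.toTD2 ε k).app (.op (V ⊗ W)) (Duality.mkForm _) :
      V ⊗ W ⟶ 𝔇.D.obj (.op (V ⊗ W)))
    rw [Duality.toTD2_mkForm, hu]
    change IsIso (snd V W ≫ 𝔇.D.map (fst V W).op +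
      (ε : ℤ) • fst V W ≫ η ≫ 𝔇.D.map (snd V W).op : V ⊗ W ⟶ 𝔇.D.obj (.op (V ⊗ W)))
    let i : V ⟶ V ⊗ W := lift (𝟙 _) 0
    let j : W ⟶ V ⊗ W := lift 0 (𝟙 _)
    have hi : i ≫ fst _ _ = 𝟙 _ := lift_fst _ _
    have hi' : i ≫ snd _ _ = 0 := lift_snd _ _
    have hj : j ≫ fst _ _ = 0 := lift_fst _ _
    have hj' : j ≫ snd _ _ = 𝟙 _ := lift_snd _ _
    have hij : fst _ _ ≫ i + snd _ _ ≫ j = 𝟙 (V ⊗ W) := by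
      ext <;> simp [hi, hi', hj, hj']
    have ki : 𝔇.D.map (fst V W).op ≫ 𝔇.D.map i.op = 𝟙 _ := by
      rw [← 𝔇.D.map_comp, ← op_comp, hi, op_id, 𝔇.D.map_id]
    have ki' : 𝔇.D.map (snd V W).op ≫ 𝔇.D.map i.op = 0 := by
      rw [← 𝔇.D.map_comp, ← op_comp, hi', 𝔇.map_zero']
    have kj : 𝔇.D.map (fst V W).op ≫ 𝔇.D.map j.op = 0 := by
      rw [← 𝔇.D.map_comp, ← op_comp, hj, 𝔇.map_zero']
    have kj' : 𝔇.D.map (snd V W).op ≫ 𝔇.D.map j.op = 𝟙 _ := by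
      rw [← 𝔇.D.map_comp, ← op_comp, hj', op_id, 𝔇.D.map_id]
    have kij : 𝔇.D.map i.op ≫ 𝔇.D.map (fst V W).op +
        𝔇.D.map j.op ≫ 𝔇.D.map (snd V W).op = 𝟙 _ := by
      rw [← 𝔇.D.map_comp, ← 𝔇.D.map_comp, ← op_comp, ← op_comp, ← 𝔇.map_add, hij, op_id,
        𝔇.D.map_id]
    have hε : ((ε : ℤ) * (ε : ℤ)) = 1 := by
      rw [← Units.val_mul, Int.units_mul_self, Units.val_one]
    -- The norm of the chosen form is the antidiagonal matrix with entries `1` and `ε η`; this is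
    -- its inverse, as `ε² = 1`.
    refine ⟨𝔇.D.map i.op ≫ j + (ε : ℤ) • 𝔇.D.map j.op ≫ inv η ≫ i, ?_, ?_⟩
    · rw [← hij, add_comm]
      simp [reassoc_of% ki, reassoc_of% ki', reassoc_of% kj, reassoc_of% kj', smul_smul, hε]
      exact add_comm _ _
    · simp [reassoc_of% hi, reassoc_of% hi', reassoc_of% hj, reassoc_of% hj', smul_smul, hε, kij]

lemma exists_retract (V : A) : ∃ (x : Herm 𝔇 ε k) (i : V ⟶ x.carrier) (r : x.carrier ⟶ V),
    i ≫ r = 𝟙 V :=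
  ⟨hyperbolic V, lift (𝟙 _) 0, fst _ _, lift_fst _ _⟩

lemma hom_associator (x y z : Herm 𝔇 ε k) :
    hom (α_ x y z).hom = (α_ x.carrier y.carrier z.carrier).hom := rfl

lemma hom_associator_inv (x y z : Herm 𝔇 ε k) :
    hom (α_ x y z).inv = (α_ x.carrier y.carrier z.carrier).inv := rfl

lemma hom_braiding (x y : Herm 𝔇 ε k) :
    hom (β_ x y).hom = (β_ x.carrier y.carrier).hom := rfl

lemma hom_tensorSwap (x y z : Herm 𝔇 ε k) :
    hom (tensorSwap x y z).hom = (tensorSwap x.carrier y.carrier z.carrier).hom := rfl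

end Herm

end FormsCalculus

/-! ### Restricting and shifting natural families -/

namespace SumCocone

variable {M : Type w} [SmallCategory M] [MonoidalCategory M]
  {B : Type u} [Category.{w} B] {F : M ⥤ B} {Y : M} {W : B}

/-- The restriction of a family of morphisms `F(t ⊕ Y) ⟶ W` along `a : Y' ⟶ Y`. -/
def restrict (c : SumCocone F Y W) {Y' : M} (a : Y' ⟶ Y) : SumCocone F Y' W where
  app t := F.map (t ◁ a) ≫ c.app t
  w h := by rw [← F.map_comp_assoc, ← whisker_exchange, F.map_comp_assoc, c.w]

/-- The family of morphisms `F(t ⊕ (T ⊕ Y)) ≅ F((t ⊕ T) ⊕ Y) ⟶ W`. -/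
def shift (c : SumCocone F Y W) (T : M) : SumCocone F (T ⊗ Y) W where
  app t := F.map (α_ t T Y).inv ≫ c.app (t ⊗ T)
  w h := by rw [← F.map_comp_assoc, associator_inv_naturality_left, F.map_comp_assoc, c.w]

variable (c : SumCocone F Y W)

lemma restrict_id : c.restrict (𝟙 Y) = c := by
  ext t
  simp [restrict]

lemma restrict_restrict {Y' Y'' : M} (a : Y' ⟶ Y) (b : Y'' ⟶ Y') :
    (c.restrict a).restrict b = c.restrict (b ≫ a) := by
  ext t
  simp [restrict]

lemma restrict_injective {Y' : M} (e : Y' ≅ Y) {c c' : SumCocone F Y W}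
    (h : c.restrict e.hom = c'.restrict e.hom) : c = c' := by
  rw [← c.restrict_id, ← e.inv_hom_id, ← restrict_restrict, h, restrict_restrict, e.inv_hom_id,
    restrict_id]

lemma shift_restrict_whiskerLeft (T : M) {Y' : M} (a : Y' ⟶ Y) :
    (c.shift T).restrict (T ◁ a) = (c.restrict a).shift T := by
  ext t
  dsimp only [restrict, shift]
  rw [← F.map_comp_assoc, ← F.map_comp_assoc, associator_inv_naturality_right]

lemma shift_restrict_whiskerRight {T T' : M} (h : T ⟶ T') :
    (c.shift T').restrict (h ▷ Y) = c.shift T := by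
  ext t
  dsimp only [restrict, shift]
  rw [← F.map_comp_assoc, associator_inv_naturality_middle, F.map_comp_assoc, c.w]

lemma shift_shift (s t : M) :
    (c.shift t).shift s = (c.shift (s ⊗ t)).restrict (α_ s t Y).inv := by
  ext r
  dsimp only [restrict, shift]
  rw [← c.w (α_ r s t).hom]
  simp only [← F.map_comp_assoc]
  congr 2
  simp

/-- Naturality of the family along `t ⟶ t ⊕ T` absorbs the extra summand. -/
lemma shift_restrict_unitTo [UnitInitial M] (T : M) :
    (c.shift T).restrict (unitTo T Y) = c := by
  ext t
  dsimp only [restrict, shift]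
  rw [← c.w ((ρ_ t).inv ≫ t ◁ UnitInitial.isInitial.to T), ← F.map_comp_assoc]
  congr 2
  simp [unitTo]

lemma shift_restrict_app_unit {T Z : M} (φ : Z ⟶ T ⊗ Y) :
    ((c.shift T).restrict φ).app (𝟙_ M) = F.map (λ_ Z).hom ≫ F.map φ ≫ c.app T := by
  dsimp only [restrict, shift]
  rw [← c.w (λ_ T).inv]
  simp only [← F.map_comp_assoc]
  congr 2
  simp [← leftUnitor_inv_whiskerRight]

lemma shift_shift_comm [SymmetricCategory M] (s t : M) :
    ((c.shift t).shift s).restrict (tensorSwap t s Y).hom = (c.shift s).shift t := by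
  rw [shift_shift, shift_shift, restrict_restrict, ← c.shift_restrict_whiskerRight (β_ t s).hom,
    restrict_restrict]
  simp [tensorSwap]

section Preadditive

variable [Preadditive B]

instance : Add (SumCocone F Y W) where
  add c c' :=
    { app := fun t => c.app t + c'.app t
      w := fun h => by rw [Preadditive.comp_add, c.w, c'.w] }

instance : Zero (SumCocone F Y W) where
  zero :=
    { app := fun _ => 0
      w := fun _ => comp_zero }

lemma add_app (c c' : SumCocone F Y W) (t : M) : (c + c').app t = c.app t + c'.app t := rfl

lemma zero_app (t : M) : (0 : SumCocone F Y W).app t = 0 := rfl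

lemma add_restrict (c c' : SumCocone F Y W) {Y' : M} (a : Y' ⟶ Y) :
    (c + c').restrict a = c.restrict a + c'.restrict a := by
  ext t
  simp [restrict, add_app]

lemma add_shift (c c' : SumCocone F Y W) (T : M) :
    (c + c').shift T = c.shift T + c'.shift T := by
  ext t
  simp [shift, add_app]

@[simp]
lemma zero_restrict {Y' : M} (a : Y' ⟶ Y) : (0 : SumCocone F Y W).restrict a = 0 := by
  ext t
  simp [restrict, zero_app]

@[simp]
lemma zero_shift (T : M) : (0 : SumCocone F Y W).shift T = 0 := by
  ext t
  simp [shift, zero_app]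

lemma add_zero' (c : SumCocone F Y W) : c + 0 = c := by
  ext t
  simp [zero_app, add_app]

lemma zero_add' (c : SumCocone F Y W) : 0 + c = c := by
  ext t
  simp [zero_app, add_app]

lemma kills_iff {S : ∀ ⦃Y' : M⦄, (Y' ⟶ Y) → Prop} :
    c.Kills S ↔ ∀ ⦃Y' : M⦄ (a : Y' ⟶ Y), S a → c.restrict a = 0 :=
  ⟨fun h Y' a ha => by ext t; exact h a ha t,
    fun h Y' a ha t => congrArg (fun d => SumCocone.app d t) (h a ha)⟩

end Preadditive

variable [Abelian B] [UnitInitial M] [SymmetricCategory M] [IsGrothendieckAbelian.{w} B]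

lemma eq_of_restrict_eq {n : ℕ} (hF : PolF n F) {S : ∀ ⦃Y' : M⦄, (Y' ⟶ Y) → Prop}
    (hY : IsSum n Y S) {c c' : SumCocone F Y W}
    (h : ∀ ⦃Y' : M⦄ (a : Y' ⟶ Y), S a → c.restrict a = c'.restrict a) : c = c' := by
  ext t
  exact app_eq hF hY c c' (fun Y' a ha t => congrArg (fun d => SumCocone.app d t) (h a ha)) t

/-- Both sides agree after omitting `z₁`, `z₂` or one of the `n` parts of `Y`, and a functor in
`PolF (n + 2)` does not see more. So a family vanishing when both `z₁` and `z₂` are omitted is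
additive in them. -/
lemma eq_add_of_kills {n : ℕ} (hF : PolF (n + 2) F) {S : ∀ ⦃Y' : M⦄, (Y' ⟶ Y) → Prop}
    (hY : IsSum n Y S) {z₁ z₂ : M} (g : SumCocone F (z₁ ⊗ (z₂ ⊗ Y)) W)
    (h₁ : (g.restrict (z₁ ◁ unitTo z₂ Y)).Kills (ConsOmits z₁ S))
    (h₂ : (g.restrict (unitTo z₁ (z₂ ⊗ Y))).Kills (ConsOmits z₂ S))
    (h₃ : ∀ ⦃Y' : M⦄ (a : Y' ⟶ Y), S a → g.restrict (z₁ ◁ z₂ ◁ a) = 0) :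
    g = ((g.restrict (z₁ ◁ unitTo z₂ Y)).shift z₂).restrict (tensorSwap z₁ z₂ Y).hom +
      (g.restrict (unitTo z₁ (z₂ ⊗ Y))).shift z₁ := by
  rw [kills_iff] at h₁ h₂
  refine eq_of_restrict_eq hF (.cons _ _ _ _ (.cons _ _ _ _ hY)) ?_
  rintro Y' a (_ | ⟨a, _ | ⟨a, ha⟩⟩)
  · rw [add_restrict, restrict_restrict, unitTo_tensorSwap, shift_restrict_whiskerLeft,
      h₁ _ .head, shift_restrict_unitTo, zero_shift, zero_add']
  · have h : z₁ ◁ unitTo z₂ Y ≫ (tensorSwap z₁ z₂ Y).hom = unitTo z₂ _ := by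
      rw [← unitTo_tensorSwap, Category.assoc]
      simp [tensorSwap, ← comp_whiskerRight_assoc]
    rw [add_restrict, restrict_restrict, h, shift_restrict_whiskerLeft (T := z₁),
      h₂ _ .head, shift_restrict_unitTo, zero_shift, add_zero']
  · rw [add_restrict, restrict_restrict, tensorSwap_naturality_right, ← restrict_restrict,
      shift_restrict_whiskerLeft, shift_restrict_whiskerLeft, h₁ _ (.tail _ ha),
      h₂ _ (.tail _ ha), h₃ _ ha]
    simp [add_zero']

end SumCocone

/-! ### Isotropic graphs and a reflection on four copies of an object -/

section Reflections

open CartesianMonoidalCategory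

variable {A : Type w} [SmallCategory A] [Preadditive A] [CartesianMonoidalCategory A]
  [BraidedCategory A] {𝔇 : Duality A} {ε : ℤˣ} {k : FormKind}

namespace Herm

@[simp]
lemma carrier_tensor (x y : Herm 𝔇 ε k) : (x ⊗ y).obj.obj = x.carrier ⊗ y.carrier := rfl

@[simp]
lemma carrier_opposite (x : Herm 𝔇 ε k) : x.opposite.obj.obj = x.carrier := rfl

lemma q_lift (x y : Herm 𝔇 ε k) {P : A} (f : P ⟶ x.carrier) (g : P ⟶ y.carrier) :
    (x ⊗ y).q (lift f g) = x.q f + y.q g :=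
  (q_tensor _ _ _).trans (by rw [lift_fst, lift_snd])

lemma q_lift_opposite (y : Herm 𝔇 ε k) {P : A} (f g : P ⟶ y.carrier) :
    (y ⊗ y.opposite).q (lift f g) = y.q f - y.q g := by
  rw [sub_eq_add_neg, ← q_opposite]
  exact q_lift y y.opposite f g

lemma q_id_tensor (x y : Herm 𝔇 ε k) :
    (x ⊗ y).q (𝟙 _) = x.q (fst x.carrier y.carrier) + y.q (snd x.carrier y.carrier) :=
  (q_tensor _ _ _).trans (by simp)

/-- The morphism to an orthogonal sum with given components. -/
noncomputable def liftHom {z x y : Herm 𝔇 ε k} (f : z.carrier ⟶ x.carrier)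
    (g : z.carrier ⟶ y.carrier) (w : x.q f + y.q g = z.q (𝟙 _)) : z ⟶ x ⊗ y :=
  mkHom (lift f g) ((q_lift _ _ _ _).trans w)

@[simp]
lemma hom_liftHom {z x y : Herm 𝔇 ε k} (f : z.carrier ⟶ x.carrier)
    (g : z.carrier ⟶ y.carrier) (w : x.q f + y.q g = z.q (𝟙 _)) :
    hom (liftHom f g w) = lift f g := rfl

lemma q_fst_add_q_snd {z x y : Herm 𝔇 ε k} (f : z ⟶ x ⊗ y) :
    x.q (hom f ≫ fst x.carrier y.carrier) + y.q (hom f ≫ snd x.carrier y.carrier) =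
      z.q (𝟙 _) :=
  (q_tensor x y (hom f)).symm.trans (by simpa using q_hom f (𝟙 z.carrier))

/-- The morphism `Y ⟶ s ⊕ Y` whose first component is an isotropic morphism `c`. -/
noncomputable def graph {s Y : Herm 𝔇 ε k} (c : Y.carrier ⟶ s.carrier) (hc : s.q c = 0) :
    Y ⟶ s ⊗ Y :=
  liftHom c (𝟙 _) (by rw [hc, zero_add])

@[simp]
lemma hom_graph {s Y : Herm 𝔇 ε k} (c : Y.carrier ⟶ s.carrier) (hc : s.q c = 0) :
    hom (graph c hc) = lift c (𝟙 _) := rfl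

lemma q_comp_eq_zero {s : Herm 𝔇 ε k} {P Q : A} (c : P ⟶ s.carrier) (hc : s.q c = 0) (f : Q ⟶ P) :
    s.q (f ≫ c) = 0 := by
  rw [← res_q, hc, map_zero]

lemma comp_graph {s Y Y' : Herm 𝔇 ε k} (c : Y.carrier ⟶ s.carrier) (hc : s.q c = 0)
    (a : Y' ⟶ Y) : a ≫ graph c hc = graph (hom a ≫ c) (q_comp_eq_zero c hc _) ≫ s ◁ a := by
  apply hom_ext
  simp only [hom_comp, hom_graph, hom_whiskerLeft]
  dsimp only [carrier_tensor]
  ext <;> simp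

section Reflection

variable (y : Herm 𝔇 ε k)

/-- Subtracting `s` from all coordinates adds `(1 + 1 + 1 - 1) q(s) = 2 q(s)` and removes the polar
form of `s` with itself, which is `2 q(s)`. -/
lemma q_reflection {P : A} (x₁ x₂ x₃ x₄ s : P ⟶ y.carrier) (hs : s = x₁ + x₂ + x₃ - x₄) :
    y.q (x₂ - s) + (y.q (x₃ - s) - y.q (x₄ - s)) + y.q (x₁ - s) =
      y.q x₁ + y.q x₂ + (y.q x₃ - y.q x₄) := by
  have h : y.polar x₁ s + y.polar x₂ s + y.polar x₃ s - y.polar x₄ s = y.q s + y.q s := by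
    rw [← polar_self]
    nth_rw 5 [hs]
    simp only [sub_eq_add_neg, polar_add_left, polar_neg_left]
  simp only [sub_eq_add_neg (b := s), q_add, polar_neg_right, q_neg]
  have h' := sub_eq_zero.2 h
  rw [← sub_eq_zero]
  refine Eq.trans ?_ (neg_eq_zero.2 h')
  abel

/-- The morphism from `(y ⊕ y) ⊕ (y ⊕ ȳ)` to `(y ⊕ (y ⊕ ȳ)) ⊕ y` which is, up to the order of the
summands, the reflection `x ↦ x - b(x, e) e`, where `e = (1, 1, 1, 1)`. -/
noncomputable def reflection : (y ⊗ y) ⊗ (y ⊗ y.opposite) ⟶ (y ⊗ (y ⊗ y.opposite)) ⊗ y :=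
  let V := y.carrier
  let x₁ : (V ⊗ V) ⊗ (V ⊗ V) ⟶ V := fst _ _ ≫ fst _ _
  let x₂ : (V ⊗ V) ⊗ (V ⊗ V) ⟶ V := fst _ _ ≫ snd _ _
  let x₃ : (V ⊗ V) ⊗ (V ⊗ V) ⟶ V := snd _ _ ≫ fst _ _
  let x₄ : (V ⊗ V) ⊗ (V ⊗ V) ⟶ V := snd _ _ ≫ snd _ _
  let s := x₁ + x₂ + x₃ - x₄
  mkHom (lift (lift (x₂ - s) (lift (x₃ - s) (x₄ - s))) (x₁ - s)) (by
    refine Eq.trans ((q_lift (y ⊗ (y ⊗ y.opposite)) y _ _).trans (congrArg (· + y.q (x₁ - s))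
      ((q_lift y (y ⊗ y.opposite) _ _).trans (congrArg (y.q (x₂ - s) + ·)
        (q_lift_opposite y _ _))))) ?_
    refine (y.q_reflection _ _ _ _ _ rfl).trans
      (Eq.trans ?_ (q_id_tensor (y ⊗ y) (y ⊗ y.opposite)).symm)
    exact congrArg₂ (· + ·) (q_tensor y y _).symm ((sub_eq_add_neg _ _).trans
      (congrArg _ (q_opposite _ _).symm) |>.trans (q_tensor y y.opposite _).symm))

/-- The morphism whose composition with `reflectionSum` is the inclusion of `y ⊕ Y`. -/
noncomputable def reflectionSection (Y : Herm 𝔇 ε k) :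
    y ⊗ Y ⟶ (y ⊗ y) ⊗ ((y ⊗ y.opposite) ⊗ Y) :=
  let V := y.carrier
  let a : V ⊗ Y.carrier ⟶ V := - fst _ _
  liftHom (x := y ⊗ y) (y := (y ⊗ y.opposite) ⊗ Y) (lift 0 a) (lift (lift a a) (snd _ _)) (by
    refine Eq.trans (congrArg₂ (· + ·) (q_lift y y _ _) ((q_lift (y ⊗ y.opposite) Y _ _).trans
      (congrArg (· + _) (q_lift_opposite y _ _)))) ?_
    refine Eq.trans ?_ (q_id_tensor _ _).symm
    simp only [q_zero, zero_add, sub_self, a]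
    exact congrArg (· + _) (y.q_neg _))

/-- The reflection on the first summands of a sum. -/
noncomputable def reflectionSum (Y : Herm 𝔇 ε k) :
    (y ⊗ y) ⊗ ((y ⊗ y.opposite) ⊗ Y) ⟶ (y ⊗ (y ⊗ y.opposite)) ⊗ (y ⊗ Y) :=
  (α_ _ _ _).inv ≫ y.reflection ▷ Y ≫ (α_ _ _ _).hom

/-- On the coordinates `(0, a, a, a)` with `a = -x` one has `s = a`, so three reflected coordinates
vanish and the first becomes `x`. -/
lemma reflectionSection_comp (Y : Herm 𝔇 ε k) :
    y.reflectionSection Y ≫ y.reflectionSum Y = unitTo _ _ := by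
  apply hom_ext
  simp only [reflectionSection, reflectionSum, reflection, hom_comp, hom_liftHom, hom_associator,
    hom_associator_inv, hom_whiskerRight, hom_mkHom, hom_unitTo]
  dsimp only [carrier_tensor, carrier_opposite]
  ext <;> simp

lemma whiskerLeft_reflectionSum {Y Y' : Herm 𝔇 ε k} (a : Y' ⟶ Y) :
    (y ⊗ y) ◁ (y ⊗ y.opposite) ◁ a ≫ y.reflectionSum Y =
      y.reflectionSum Y' ≫ (y ⊗ (y ⊗ y.opposite)) ◁ y ◁ a := by
  simp only [reflectionSum, associator_inv_naturality_right_assoc, Category.assoc,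
    whisker_exchange_assoc, associator_naturality_right]

end Reflection

end Herm

end Reflections

/-! ### Invariance of the families under isotropic components -/

section Elimination

open CartesianMonoidalCategory Herm

variable {A : Type w} [SmallCategory A] [Preadditive A] [CartesianMonoidalCategory A]
  [BraidedCategory A] {𝔇 : Duality A} {ε : ℤˣ} {k : FormKind}
  {B : Type u} [Category.{w} B] [Abelian B] [IsGrothendieckAbelian.{w} B]
  {F : Herm 𝔇 ε k ⥤ B} {W : B} {n : ℕ} {Y : Herm 𝔇 ε k}
  {S : ∀ ⦃Y' : Herm 𝔇 ε k⦄, (Y' ⟶ Y) → Prop}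

namespace SumCocone

/-- Only the restriction of `κ` to `Y` matters. Both sides are families on `t ⊕ Y`, a sum with `n +
1` omissions: omitting `t` makes them equal by `h`, and the omissions in `Y` kill both. -/
lemma shift_shift_restrict_graph_eq (hF : PolF (n + 1) F) (hY : IsSum n Y S)
    (c : SumCocone F Y W) (hc : c.Kills S) {s t : Herm 𝔇 ε k}
    (κ κ' : (t ⊗ Y).carrier ⟶ s.carrier) (hκ : s.q κ = 0) (hκ' : s.q κ' = 0)
    (h : hom (unitTo t Y) ≫ κ = hom (unitTo t Y) ≫ κ') :
    ((c.shift t).shift s).restrict (graph κ hκ) = ((c.shift t).shift s).restrict (graph κ' hκ') := by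
  rw [kills_iff] at hc
  refine eq_of_restrict_eq hF (.cons _ t Y S hY) ?_
  rintro Y' a (_ | ⟨a, ha⟩)
  · rw [restrict_restrict, restrict_restrict, comp_graph, comp_graph]
    simp only [h]
  · rw [restrict_restrict, restrict_restrict, comp_graph, comp_graph, ← restrict_restrict,
      ← restrict_restrict, shift_restrict_whiskerLeft, shift_restrict_whiskerLeft, hc _ ha]
    simp

/-- The retraction of `δ` reads `y` off the summand `z'` and ignores `z`. So `κ` extends to `z' ⊕ (z
⊕ Y)` with its dependence on `y` moved into the shifted summand `z'`, where
`shift_shift_restrict_graph_eq` discards it. -/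
lemma shift_restrict_graph_eq_of_retraction (hF : PolF (n + 2) F) (hY : IsSum n Y S)
    {y z z' s : Herm 𝔇 ε k} (c : SumCocone F (z ⊗ Y) W) (hc : c.Kills (ConsOmits z S))
    (δ : y ⊗ Y ⟶ z' ⊗ (z ⊗ Y)) (r : z'.carrier ⟶ y.carrier)
    (h₁ : hom δ ≫ fst z'.carrier (z.carrier ⊗ Y.carrier) ≫ r = fst y.carrier Y.carrier)
    (h₂ : hom δ ≫ snd z'.carrier (z.carrier ⊗ Y.carrier) ≫ snd z.carrier Y.carrier =
      snd y.carrier Y.carrier)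
    (κ κ' : (y ⊗ Y).carrier ⟶ s.carrier) (hκ : s.q κ = 0) (hκ' : s.q κ' = 0)
    (h : hom (unitTo y Y) ≫ κ = hom (unitTo y Y) ≫ κ') :
    (((c.shift z').restrict δ).shift s).restrict (graph κ hκ) =
      (((c.shift z').restrict δ).shift s).restrict (graph κ' hκ') := by
  let e : (z' ⊗ (z ⊗ Y)).carrier ⟶ (y ⊗ Y).carrier :=
    lift (fst z'.carrier (z.carrier ⊗ Y.carrier) ≫ r)
      (snd z'.carrier (z.carrier ⊗ Y.carrier) ≫ snd z.carrier Y.carrier)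
  have he : hom δ ≫ e = 𝟙 _ := by
    apply CartesianMonoidalCategory.hom_ext
    · simpa [e] using h₁
    · simpa [e] using h₂
  have he' : hom (unitTo z' (z ⊗ Y)) ≫ e = snd z.carrier Y.carrier ≫ hom (unitTo y Y) := by
    rw [hom_unitTo, hom_unitTo]
    dsimp only [e]
    apply CartesianMonoidalCategory.hom_ext
    · simp
    · simp
  have key (κ : (y ⊗ Y).carrier ⟶ s.carrier) (hκ : s.q κ = 0) :
      (((c.shift z').restrict δ).shift s).restrict (graph κ hκ) =
        (((c.shift z').shift s).restrict (graph (e ≫ κ) (q_comp_eq_zero κ hκ e))).restrict δ := by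
    rw [← shift_restrict_whiskerLeft, restrict_restrict, restrict_restrict, comp_graph]
    simp only [reassoc_of% he]
  rw [key, key, shift_shift_restrict_graph_eq hF (.cons _ z Y S hY) c hc (e ≫ κ) (e ≫ κ')]
  rw [reassoc_of% he', reassoc_of% he', h]

/-- The family `c`, shifted and pulled back along the reflection, is additive in the blocks `y ⊕ y`
and `y ⊕ ȳ`, and `reflectionSection` recovers `c` from it. Since this section maps `y` nontrivially
to both blocks, each term still sees `y` in the block that it ignores. -/
lemma exists_eq_add (hF : PolF (n + 2) F) (hY : IsSum n Y S) {y : Herm 𝔇 ε k}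
    (c : SumCocone F (y ⊗ Y) W) (hc : c.Kills (ConsOmits y S)) :
    ∃ (c₁ : SumCocone F ((y ⊗ y) ⊗ Y) W) (c₂ : SumCocone F ((y ⊗ y.opposite) ⊗ Y) W),
      c₁.Kills (ConsOmits _ S) ∧ c₂.Kills (ConsOmits _ S) ∧
      c = (c₁.shift _).restrict (y.reflectionSection Y ≫ (tensorSwap _ _ _).hom) +
        (c₂.shift _).restrict (y.reflectionSection Y) := by
  rw [kills_iff] at hc
  let g := (c.shift (y ⊗ (y ⊗ y.opposite))).restrict (y.reflectionSum Y)
  have hg : c = g.restrict (y.reflectionSection Y) := by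
    rw [restrict_restrict, reflectionSection_comp, shift_restrict_unitTo]
  have hS ⦃Y' : Herm 𝔇 ε k⦄ (a : Y' ⟶ Y) (ha : S a) :
      g.restrict ((y ⊗ y) ◁ (y ⊗ y.opposite) ◁ a) = 0 := by
    rw [restrict_restrict, whiskerLeft_reflectionSum, ← restrict_restrict,
      shift_restrict_whiskerLeft, hc _ (.tail _ ha)]
    simp
  -- The reflection fixes zero: omitting both blocks amounts to omitting the original `y`.
  have h₀ : g.restrict (unitTo (y ⊗ y.opposite) Y ≫ unitTo (y ⊗ y) _) = 0 := by
    have h : (unitTo (y ⊗ y.opposite) Y ≫ unitTo (y ⊗ y) _) ≫ y.reflectionSum Y =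
        unitTo y Y ≫ unitTo _ _ := by
      apply Herm.hom_ext
      simp only [reflectionSum, reflection, Herm.hom_comp, hom_associator,
        hom_associator_inv, hom_whiskerRight, hom_mkHom, hom_unitTo]
      dsimp only [carrier_tensor, carrier_opposite]
      ext <;> simp
    rw [restrict_restrict, h, ← restrict_restrict, shift_restrict_unitTo, hc _ .head]
  have h₁ : (g.restrict ((y ⊗ y) ◁ unitTo (y ⊗ y.opposite) Y)).Kills (ConsOmits _ S) := by
    rw [kills_iff]
    rintro Y' a (_ | ⟨a, ha⟩)
    · rw [restrict_restrict, ← unitTo_naturality, h₀]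
    · rw [restrict_restrict, ← MonoidalCategory.whiskerLeft_comp, unitTo_naturality,
        MonoidalCategory.whiskerLeft_comp, ← restrict_restrict, hS a ha, zero_restrict]
  have h₂ : (g.restrict (unitTo (y ⊗ y) ((y ⊗ y.opposite) ⊗ Y))).Kills (ConsOmits _ S) := by
    rw [kills_iff]
    rintro Y' a (_ | ⟨a, ha⟩)
    · rw [restrict_restrict, h₀]
    · rw [restrict_restrict, unitTo_naturality, ← restrict_restrict, hS a ha, zero_restrict]
  refine ⟨_, _, h₁, h₂, ?_⟩
  rw [← restrict_restrict, ← add_restrict, ← eq_add_of_kills hF hY g h₁ h₂ hS, hg]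

/-- The values of `κ` on `y` are irrelevant for both terms of `exists_eq_add`. The retraction is
minus the second projection since the section has the component `-y` there, in either block. -/
lemma shift_restrict_graph_eq (hF : PolF (n + 2) F) (hY : IsSum n Y S) {y s : Herm 𝔇 ε k}
    (c : SumCocone F (y ⊗ Y) W) (hc : c.Kills (ConsOmits y S))
    (κ κ' : (y ⊗ Y).carrier ⟶ s.carrier) (hκ : s.q κ = 0) (hκ' : s.q κ' = 0)
    (h : hom (unitTo y Y) ≫ κ = hom (unitTo y Y) ≫ κ') :
    (c.shift s).restrict (graph κ hκ) = (c.shift s).restrict (graph κ' hκ') := by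
  obtain ⟨c₁, c₂, h₁, h₂, rfl⟩ := exists_eq_add hF hY c hc
  rw [add_shift, add_restrict, add_restrict]
  congr 1
  · refine shift_restrict_graph_eq_of_retraction hF hY c₁ h₁ _ (-snd _ _) ?_ ?_ κ κ' hκ hκ' h
    · simp only [reflectionSection, Herm.hom_comp, hom_liftHom, hom_tensorSwap]
      dsimp only [carrier_tensor, carrier_opposite]
      simp only [tensorSwap]
      simp
      exact (Preadditive.comp_neg _ _).trans (by rw [lift_snd, neg_neg])
    · simp only [reflectionSection, Herm.hom_comp, hom_liftHom, hom_tensorSwap]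
      dsimp only [carrier_tensor, carrier_opposite]
      simp [tensorSwap]
  · refine shift_restrict_graph_eq_of_retraction hF hY c₂ h₂ _ (-snd _ _) ?_ ?_ κ κ' hκ hκ' h
    · simp only [reflectionSection, hom_liftHom]
      dsimp only [carrier_tensor, carrier_opposite]
      simp
    · simp only [reflectionSection, hom_liftHom]
      dsimp only [carrier_tensor, carrier_opposite]
      simp

lemma shift_restrict_graph (hF : PolF (n + 1) F) (hY : IsSum n Y S)
    (c : SumCocone F Y W) (hc : c.Kills S) {s : Herm 𝔇 ε k} (κ : Y.carrier ⟶ s.carrier)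
    (hκ : s.q κ = 0) : (c.shift s).restrict (graph κ hκ) = c := by
  induction hY generalizing F with
  | base v =>
    -- For `PolF 1` one omission is needed: `v` is written `v ⊕ 0`, and after omitting `v` the two
    -- sides agree because the source is initial.
    refine restrict_injective (ρ_ v) (eq_of_restrict_eq hF (.cons _ v (𝟙_ _) _ (.base _)) ?_)
    rintro Y' a (_ | ⟨a, ha⟩)
    · have h : (unitTo v (𝟙_ _) ≫ (ρ_ v).hom) ≫ graph κ hκ =
          (unitTo v (𝟙_ _) ≫ (ρ_ v).hom) ≫ unitTo s v :=
        UnitInitial.isInitial.hom_ext _ _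
      rw [restrict_restrict, restrict_restrict, restrict_restrict, h, ← restrict_restrict,
        shift_restrict_unitTo]
    · exact ha.elim
  | cons n y Y S hY ih =>
    -- Once `κ` is replaced by a morphism which ignores `y`, its graph is compatible with the
    -- descent of `c` to `δ_y F`, where the induction hypothesis applies.
    let κ' : Y.carrier ⟶ s.carrier := hom (unitTo y Y) ≫ κ
    have hκ' : s.q κ' = 0 := q_comp_eq_zero κ hκ _
    have h : (c.shift s).restrict (graph κ hκ) = (c.shift s).restrict
        (graph (Y := y ⊗ Y) (snd y.carrier Y.carrier ≫ κ') (q_comp_eq_zero κ' hκ' _)) := by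
      refine shift_restrict_graph_eq hF hY c hc _ _ hκ _ ?_
      rw [hom_unitTo, unitTo_snd_assoc]
      rfl
    rw [h]
    obtain ⟨d, hd⟩ := exists_delta_desc c fun t => hc _ .head t
    have hd' := ih (hF y) d (kills_of_desc c hc d hd) κ' hκ'
    ext t
    rw [← cancel_epi (F.map (tensorSwap y t Y).hom), ← hd, ← hd']
    dsimp only [restrict, shift]
    have h' : ((deltaπ y).app F).app (t ⊗ Y) ≫
        ((delta y).obj F).map (t ◁ graph κ' hκ' ≫ (α_ t s Y).inv) =
      F.map (y ◁ (t ◁ graph κ' hκ' ≫ (α_ t s Y).inv)) ≫ ((deltaπ y).app F).app ((t ⊗ s) ⊗ Y) :=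
      (((deltaπ y).app F).naturality _).symm
    rw [← ((delta y).obj F).map_comp_assoc, reassoc_of% h', hd]
    simp only [← F.map_comp_assoc]
    congr 2
    apply Herm.hom_ext
    simp only [Herm.hom_comp, hom_tensorSwap, hom_whiskerLeft, hom_graph, hom_associator_inv]
    dsimp only [carrier_tensor]
    ext <;> simp [tensorSwap]

/-- The morphism `κ` may be replaced by one that ignores `t`; the two shifts are then exchanged to
reduce to `shift_restrict_graph`. -/
lemma shift_shift_restrict_graph (hF : PolF (n + 1) F) (hY : IsSum n Y S)
    (c : SumCocone F Y W) (hc : c.Kills S) {s t : Herm 𝔇 ε k} (κ : (t ⊗ Y).carrier ⟶ s.carrier)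
    (hκ : s.q κ = 0) : ((c.shift t).shift s).restrict (graph κ hκ) = c.shift t := by
  let κ' : Y.carrier ⟶ s.carrier := hom (unitTo t Y) ≫ κ
  have hκ' : s.q κ' = 0 := q_comp_eq_zero κ hκ _
  have h : hom (unitTo t Y) ≫ κ = hom (unitTo t Y) ≫ snd t.carrier Y.carrier ≫ κ' := by
    rw [hom_unitTo, unitTo_snd_assoc]
    rfl
  rw [shift_shift_restrict_graph_eq hF hY c hc κ _ hκ (q_comp_eq_zero κ' hκ' _) h]
  conv_rhs => rw [← shift_restrict_graph hF hY c hc κ' hκ', ← shift_restrict_whiskerLeft,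
    ← shift_shift_comm, restrict_restrict]
  congr 1
  apply Herm.hom_ext
  simp only [Herm.hom_comp, hom_tensorSwap, hom_whiskerLeft, hom_graph]
  dsimp only [carrier_tensor]
  ext <;> simp [tensorSwap]

lemma map_graph_comp_app (hF : PolF (n + 1) F) (hY : IsSum n Y S)
    (c : SumCocone F Y W) (hc : c.Kills S) {s t : Herm 𝔇 ε k} (κ : (t ⊗ Y).carrier ⟶ s.carrier)
    (hκ : s.q κ = 0) : F.map (graph κ hκ ≫ (α_ s t Y).inv) ≫ c.app (s ⊗ t) = c.app t := by
  have h := shift_shift_restrict_graph hF hY c hc κ hκ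
  rw [shift_shift, restrict_restrict, ← (c.shift t).restrict_id] at h
  have h' := congrArg (fun d => SumCocone.app d (𝟙_ _)) h
  rw [shift_restrict_app_unit, shift_restrict_app_unit, F.map_id, Category.id_comp,
    cancel_epi] at h'
  exact h'

/-- The morphism `F(x) ⟶ W` induced by a morphism `φ : x ⟶ t ⊕ Y` depends only on the second
component of `φ`. -/
theorem map_comp_app_eq (hF : PolF (n + 1) F) (hY : IsSum n Y S)
    (c : SumCocone F Y W) (hc : c.Kills S) {x t t' : Herm 𝔇 ε k} (φ : x ⟶ t ⊗ Y) (φ' : x ⟶ t' ⊗ Y)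
    (h : hom φ ≫ snd t.carrier Y.carrier = hom φ' ≫ snd t'.carrier Y.carrier) :
    F.map φ ≫ c.app t = F.map φ' ≫ c.app t' := by
  obtain ⟨r, hr⟩ := exists_retraction φ
  obtain ⟨r', hr'⟩ := exists_retraction φ'
  let e : x.carrier ⟶ t.carrier := hom φ ≫ fst t.carrier Y.carrier
  let e' : x.carrier ⟶ t'.carrier := hom φ' ≫ fst t'.carrier Y.carrier
  have he : t.q e = t'.q e' := by
    have h₁ := (q_fst_add_q_snd φ).trans (q_fst_add_q_snd φ').symm
    rw [h] at h₁
    exact add_right_cancel h₁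
  -- With these isotropic components added, `φ` has components `(e', e', e)` and `φ'` has `(e, e',
  -- e')` besides the common one in `Y`. They differ by the permutation `θ`, which `c` ignores by
  -- naturality. The retractions `r`, `r'` extend the components from `x` to the whole sums.
  let κ : x.carrier ⟶ (t' ⊗ t'.opposite).carrier := lift e' e'
  let κ' : x.carrier ⟶ (t ⊗ t'.opposite).carrier := lift e e'
  have hκ : (t' ⊗ t'.opposite).q κ = 0 := (q_lift_opposite _ _ _).trans (sub_self _)
  have hκ' : (t ⊗ t'.opposite).q κ' = 0 := by
    refine (q_lift _ _ _ _).trans ?_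
    rw [he]
    exact (congrArg _ (q_opposite _ _)).trans (add_neg_cancel _)
  rw [← map_graph_comp_app hF hY c hc (r ≫ κ) (q_comp_eq_zero κ hκ r),
    ← map_graph_comp_app hF hY c hc (r' ≫ κ') (q_comp_eq_zero κ' hκ' r')]
  let θ : (t' ⊗ t'.opposite) ⊗ t ⟶ (t ⊗ t'.opposite) ⊗ t' :=
    (β_ (t' ⊗ t'.opposite) t).hom ≫ t ◁ (β_ _ _).hom ≫ (α_ _ _ _).inv
  rw [← c.w θ]
  simp only [← F.map_comp_assoc]
  congr 2
  apply Herm.hom_ext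
  simp only [Herm.hom_comp, hom_whiskerLeft, hom_whiskerRight, hom_graph, hom_braiding,
    hom_associator_inv, θ, κ, κ']
  dsimp only [carrier_tensor, carrier_opposite]
  have h₁ := reassoc_of% hr
  have h₂ := reassoc_of% hr'
  ext <;> simp [h₁, h₂, e, e', h]

end SumCocone

end Elimination

/-! ### The unit of the left Kan extension along `π^T` -/

section KanExtension

open CartesianMonoidalCategory Herm

variable {A : Type w} [SmallCategory A] [Preadditive A] [CartesianMonoidalCategory A]
  [BraidedCategory A] {𝔇 : Duality A} {ε : ℤˣ} {k : FormKind}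
  {B : Type u} [Category.{w} B] [Abelian B] [IsGrothendieckAbelian.{w} B]

/-- The left Kan extension of `F` along `π^T`. -/
noncomputable def hermLan (F : Herm 𝔇 ε k ⥤ B) : A ⥤ B :=
  have (V : A) : HasColimit (CostructuredArrow.proj (Herm.forget 𝔇 ε k) V ⋙ F) := inferInstance
  (Herm.forget 𝔇 ε k).pointwiseLeftKanExtension F

section

variable (F : Herm 𝔇 ε k ⥤ B)

/-- The morphism `F(z) ⟶ (Lan F)(V)` given by `g : π^T(z) ⟶ V`. -/
noncomputable def toHermLan {z : Herm 𝔇 ε k} {V : A} (g : z.carrier ⟶ V) :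
    F.obj z ⟶ (hermLan F).obj V :=
  colimit.ι (CostructuredArrow.proj (Herm.forget 𝔇 ε k) V ⋙ F)
    (CostructuredArrow.mk (S := Herm.forget 𝔇 ε k) g)

lemma map_toHermLan {z z' : Herm 𝔇 ε k} {V : A} (f : z ⟶ z') (g : z'.carrier ⟶ V) :
    F.map f ≫ toHermLan F g = toHermLan F (hom f ≫ g) := by
  let φ : CostructuredArrow.mk (S := Herm.forget 𝔇 ε k) (hom f ≫ g) ⟶
      CostructuredArrow.mk (S := Herm.forget 𝔇 ε k) g :=
    CostructuredArrow.homMk f rfl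
  exact colimit.w (CostructuredArrow.proj (Herm.forget 𝔇 ε k) V ⋙ F) φ

lemma toHermLan_map {z : Herm 𝔇 ε k} {V V' : A} (g : z.carrier ⟶ V) (h : V ⟶ V') :
    toHermLan F g ≫ (hermLan F).map h = toHermLan F (g ≫ h) :=
  colimit.ι_desc _ _

variable {F} in
lemma hermLan_hom_ext {V : A} {W : B} {a b : (hermLan F).obj V ⟶ W}
    (h : ∀ ⦃z : Herm 𝔇 ε k⦄ (g : z.carrier ⟶ V), toHermLan F g ≫ a = toHermLan F g ≫ b) : a = b :=
  colimit.hom_ext fun j => h j.hom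

lemma exists_hermLan_desc {V : A} {W : B}
    (m : ∀ ⦃z : Herm 𝔇 ε k⦄ (_ : z.carrier ⟶ V), F.obj z ⟶ W)
    (hm : ∀ ⦃z z' : Herm 𝔇 ε k⦄ (f : z ⟶ z') (g : z'.carrier ⟶ V),
      F.map f ≫ m g = m (hom f ≫ g)) :
    ∃ a : (hermLan F).obj V ⟶ W, ∀ ⦃z : Herm 𝔇 ε k⦄ (g : z.carrier ⟶ V),
      toHermLan F g ≫ a = m g := by
  let c : Cocone (CostructuredArrow.proj (Herm.forget 𝔇 ε k) V ⋙ F) :=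
    { pt := W
      ι :=
        { app := fun j => m (z := j.left) j.hom
          naturality := fun j j' φ => by
            refine Eq.trans ?_ (Category.comp_id _).symm
            refine (hm φ.left j'.hom).trans (congrArg (m (z := j.left)) ?_)
            exact CostructuredArrow.w φ } }
  exact ⟨colimit.desc _ c, fun z g => colimit.ι_desc c (CostructuredArrow.mk g)⟩

/-- The unit `F ⟶ (π^T)^* Lan F`. -/
noncomputable def hermLanUnit : F ⟶ Herm.forget 𝔇 ε k ⋙ hermLan F where
  app z := toHermLan F (𝟙 z.carrier)
  naturality z z' f := by
    refine (map_toHermLan F f _).trans (Eq.trans ?_ (toHermLan_map F (𝟙 z.carrier) (hom f)).symm)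
    exact congrArg (toHermLan F) ((Category.comp_id (hom f)).trans (Category.id_comp (hom f)).symm)

/-- The morphism `τ_t(F) ⟶ (π^T)^* Lan F` given by the second projection. -/
noncomputable def tauHermLan (t : Herm 𝔇 ε k) :
    (tau t).obj F ⟶ Herm.forget 𝔇 ε k ⋙ hermLan F where
  app z := toHermLan F (z := t ⊗ z) (snd t.carrier z.carrier)
  naturality z z' f := by
    refine (map_toHermLan F (t ◁ f) _).trans (Eq.trans ?_ (toHermLan_map F _ (hom f)).symm)
    rw [hom_whiskerLeft]
    exact congrArg (toHermLan F (z := t ⊗ z)) (whiskerLeft_snd _ _)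

lemma iota_tauHermLan (t : Herm 𝔇 ε k) : iota t F ≫ tauHermLan F t = hermLanUnit F := by
  ext z
  refine (map_toHermLan F (unitTo t z) _).trans ?_
  rw [hom_unitTo]
  exact congrArg (toHermLan F) (unitTo_snd _ _)

variable {F}

/-- The maps `F(t ⊕ y) ⟶ (Lan F)(y)` induced by the second projection jointly cover the target and
restrict to the unit along `i_t`; so the functors `δ_t F` cover the cokernel. -/
lemma polF_cokernel_hermLanUnit (n : ℕ) (hF : PolF (n + 1) F) :
    PolF n (cokernel (hermLanUnit F)) := by
  let m (t : Herm 𝔇 ε k) : (delta t).obj F ⟶ cokernel (hermLanUnit F) :=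
    cokernel.desc (iota t F) (tauHermLan F t ≫ cokernel.π (hermLanUnit F)) (by
      rw [← Category.assoc, iota_tauHermLan, cokernel.condition])
  have hm (t : Herm 𝔇 ε k) : (deltaπ t).app F ≫ m t = tauHermLan F t ≫ cokernel.π (hermLanUnit F) :=
    cokernel.π_desc _ _ _
  refine polF_of_jointlyEpi n m (fun y W f hf => ?_) hF
  rw [← cancel_epi ((cokernel.π (hermLanUnit F)).app y), comp_zero]
  refine hermLan_hom_ext fun z g => ?_
  -- The forms of the two copies of `g` cancel, so any `g` of `A` is the last component of a
  -- morphism preserving forms.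
  let φ : z ⟶ (z ⊗ y.opposite) ⊗ y := liftHom (x := z ⊗ y.opposite) (lift (𝟙 _) g) g (by
    refine (congrArg (· + y.q g) ((q_lift z y.opposite _ _).trans
      (congrArg _ (q_opposite _ _)))).trans ?_
    exact neg_add_cancel_right _ _)
  have hφ : hom φ ≫ snd (z ⊗ y.opposite).carrier y.carrier = g := lift_snd _ _
  have h : ((deltaπ (z ⊗ y.opposite)).app F).app y ≫ (m (z ⊗ y.opposite)).app y =
      (tauHermLan F (z ⊗ y.opposite)).app y ≫ (cokernel.π (hermLanUnit F)).app y :=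
    NatTrans.congr_app (hm _) y
  have h' : toHermLan F g = F.map φ ≫ (tauHermLan F (z ⊗ y.opposite)).app y :=
    (congrArg (toHermLan F) hφ.symm).trans (map_toHermLan F φ _).symm
  rw [comp_zero, h', Category.assoc]
  have h'' := congrArg (fun a => a ≫ f) h
  simp only [Category.assoc] at h''
  rw [← h'', hf, comp_zero, comp_zero]

/-- Each testing family `c_t` factors through the unit at `t ⊕ Y`, hence vanishes on the kernel. The
factorization is defined on `g : z ⟶ t ⊕ Y` through `(1, g₂, g₂)`, with `g₂` the component in `Y`,
and `map_comp_app_eq` makes it compatible. -/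
lemma polF_kernel_hermLanUnit (n : ℕ) (hF : PolF (n + 1) F) :
    PolF n (kernel (hermLanUnit F)) := by
  refine polF_of_sumCocone n hF (kernel.ι (hermLanUnit F)) fun Y S hY W c hc t => ?_
  obtain ⟨a, ha⟩ := exists_hermLan_desc F (V := t.carrier ⊗ Y.carrier) (W := W)
    (fun z g => F.map (liftHom (x := z ⊗ Y.opposite) (lift (𝟙 _) (g ≫ snd _ _)) (g ≫ snd _ _) (by
      refine (congrArg (· + Y.q _) ((q_lift z Y.opposite _ _).trans
        (congrArg _ (q_opposite _ _)))).trans ?_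
      exact neg_add_cancel_right _ _)) ≫ c.app (z ⊗ Y.opposite)) (fun z z' f g => by
        rw [← F.map_comp_assoc]
        refine c.map_comp_app_eq hF hY hc _ _ ?_
        rw [Herm.hom_comp, Category.assoc, hom_liftHom, hom_liftHom]
        refine (congrArg (hom f ≫ ·) (lift_snd _ _)).trans (Eq.trans ?_ (lift_snd _ _).symm)
        rw [Category.assoc])
  -- For `g` the identity, the auxiliary morphism has the same `Y`-component as the identity of `t ⊕
  -- Y`.
  have h : (hermLanUnit F).app (t ⊗ Y) ≫ a = c.app t := by
    refine (ha (z := t ⊗ Y) (𝟙 _)).trans ?_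
    refine (c.map_comp_app_eq hF hY hc _ (𝟙 (t ⊗ Y)) ?_).trans ?_
    · exact lift_snd _ _
    · rw [F.map_id, Category.id_comp]
  have h₀ : (kernel.ι (hermLanUnit F)).app (t ⊗ Y) ≫ (hermLanUnit F).app (t ⊗ Y) = 0 :=
    NatTrans.congr_app (kernel.condition (hermLanUnit F)) (t ⊗ Y)
  rw [← h]
  exact (Category.assoc _ _ _).symm.trans ((congrArg (· ≫ a) h₀).trans zero_comp)

/-- The restriction of `Lan F` is an extension of the cokernel of the unit by a quotient of `F`, and
restriction to hermitian objects detects the degree. -/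
lemma polF_hermLan (n : ℕ) (hF : PolF (n + 1) F) : PolF (n + 1) (hermLan F) := by
  refine polF_of_polF_forget_comp (𝔇 := 𝔇) (ε := ε) (k := k) exists_retract (n + 1) ?_
  refine prop_of_prop_kernel (PolF (n + 1)) (cokernel.π (hermLanUnit F)) ?_
    (polF_le_succ n _ (polF_cokernel_hermLanUnit n hF))
  exact (PolF (n + 1)).prop_of_epi (Abelian.factorThruImage (hermLanUnit F)) hF

end

end KanExtension

section

variable {C : Type*} [Category* C] [Abelian C]

lemma shortExact_kernel_of_epi {X Y : C} (f : X ⟶ Y) [Epi f] :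
    (ShortComplex.mk (kernel.ι f) f (kernel.condition f)).ShortExact where
  exact := ShortComplex.exact_of_f_is_kernel _ (kernelIsKernel f)
  mono_f := inferInstanceAs (Mono (kernel.ι f))
  epi_g := inferInstanceAs (Epi f)

lemma prop_kernel_factorThruImage (P : ObjectProperty C) [P.IsClosedUnderSubobjects] {X Y : C}
    (f : X ⟶ Y) (h : P (kernel f)) : P (kernel (Abelian.factorThruImage f)) := by
  have w : kernel.ι (Abelian.factorThruImage f) ≫ f = 0 := by
    have h' := congrArg (kernel.ι (Abelian.factorThruImage f) ≫ ·) (Abelian.image.fac f)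
    rw [← h', kernel.condition_assoc, zero_comp]
  have : Mono (kernel.lift f _ w) := by
    have : Mono (kernel.lift f _ w ≫ kernel.ι f) := by
      rw [kernel.lift_ι]
      infer_instance
    exact mono_of_mono _ (kernel.ι f)
  exact P.prop_of_mono (kernel.lift f _ w) h

end

lemma shortExact_of_iso_of_isZero {C : Type*} [Category* C] [Preadditive C] [HasZeroObject C]
    {X Y Z : C} (e : X ≅ Y) (hZ : IsZero Z) :
    (ShortComplex.mk e.hom (0 : Y ⟶ Z) comp_zero).ShortExact :=
  ShortComplex.Splitting.shortExact
    { r := e.inv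
      s := 0
      f_r := e.hom_inv_id
      s_g := hZ.eq_of_src _ _
      id := by simp }

end WeakPoly

theorem mainTheorem12 {A : Type w} [SmallCategory A] [Preadditive A] [CartesianMonoidalCategory A]
    [BraidedCategory A] (𝔇 : WeakPoly.Duality A) (ε : ℤˣ) (k : WeakPoly.FormKind)
    {B : Type u} [Category.{w} B] [Abelian B] [IsGrothendieckAbelian.{w} B] (n : ℕ) :
    IsLeast
      {C : ObjectProperty (WeakPoly.St (WeakPoly.Herm 𝔇 ε k) B) |
        (∀ F : A ⥤ B, WeakPoly.Pol A B n ((WeakPoly.proj A B).obj F) →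
          C ((WeakPoly.proj (WeakPoly.Herm 𝔇 ε k) B).obj (WeakPoly.Herm.forget 𝔇 ε k ⋙ F))) ∧
        (∀ S : ShortComplex (WeakPoly.St (WeakPoly.Herm 𝔇 ε k) B),
          S.ShortExact → C S.X₂ → C S.X₃ → C S.X₁) ∧
        (∀ S : ShortComplex (WeakPoly.St (WeakPoly.Herm 𝔇 ε k) B),
          S.ShortExact → C S.X₁ → C S.X₃ → C S.X₂)}
      (WeakPoly.Pol (WeakPoly.Herm 𝔇 ε k) B n) := by
  open WeakPoly in
  refine ⟨⟨fun F hF => ?_, fun S hS h₂ _ => pol_prop_X₁ n S hS h₂,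
    fun S hS h₁ h₃ => pol_prop_X₂ n S hS h₁ h₃⟩, ?_⟩
  · rw [pol_proj_iff] at hF ⊢
    exact polF_forget_comp (n + 1) hF
  rintro C ⟨hres, hker, hext⟩ X hX
  obtain ⟨Z, hZ⟩ := HasZeroObject.zero (C := A ⥤ B)
  have hZ' : IsZero ((proj (Herm 𝔇 ε k) B).obj (Herm.forget 𝔇 ε k ⋙ Z)) := by
    rw [isZero_proj_iff]
    exact polF_forget_comp 0 ((PolF 0).prop_of_isZero hZ)
  have hCZ : C ((proj (Herm 𝔇 ε k) B).obj (Herm.forget 𝔇 ε k ⋙ Z)) :=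
    hres _ ((pol_proj_iff _ _).2 ((PolF (n + 1)).prop_of_isZero hZ))
  have : HasZeroObject (St (Herm 𝔇 ε k) B) := ⟨_, hZ'⟩
  -- Closure under isomorphism is not assumed of `C`: it comes from sequences with zero quotient, a
  -- zero object being the image of the zero functor on `A`.
  have hiso {X Y : St (Herm 𝔇 ε k) B} (e : X ≅ Y) (hY : C Y) : C X :=
    hker _ (shortExact_of_iso_of_isZero e hZ') hY hCZ
  -- The bound `m ≤ n + 1` ensures that all Kan extensions met in the induction have degree at most
  -- `n`, so that `hres` applies.
  have key (m : ℕ) (hm : m ≤ n + 1) (F : Herm 𝔇 ε k ⥤ B) (hF : PolF m F) :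
      C ((proj (Herm 𝔇 ε k) B).obj F) := by
    induction m generalizing F with
    | zero => exact hiso (((isZero_proj_iff F).2 hF).iso hZ') hCZ
    | succ m ih =>
      have hL : C ((proj (Herm 𝔇 ε k) B).obj (Herm.forget 𝔇 ε k ⋙ hermLan F)) :=
        hres _ ((pol_proj_iff _ _).2 (polF_le hm _ (polF_hermLan m hF)))
      have hI : C ((proj (Herm 𝔇 ε k) B).obj (Abelian.image (hermLanUnit F))) := by
        obtain ⟨S, hS, h₁, h₂, h₃⟩ :=
          proj_shortExact (shortExact_kernel_of_epi (cokernel.π (hermLanUnit F)))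
        have h := hker S hS (h₂ ▸ hL) (h₃ ▸ ih (by omega) _ (polF_cokernel_hermLanUnit m hF))
        exact h₁ ▸ h
      obtain ⟨S, hS, h₁, h₂, h₃⟩ :=
        proj_shortExact (shortExact_kernel_of_epi (Abelian.factorThruImage (hermLanUnit F)))
      have h := hext S hS (h₁ ▸ ih (by omega) _ (prop_kernel_factorThruImage _ _
        (polF_kernel_hermLanUnit m hF))) (h₃ ▸ hI)
      exact h₂ ▸ h
  let e := (proj (Herm 𝔇 ε k) B).objObjPreimageIso X
  exact hiso e.symm (key (n + 1) le_rfl _ ((pol_proj_iff _ _).1 ((pol_iso_iff n e).2 hX)))
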